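/- Let $\sigma_{\min},\sigma_{\max},a>0$. There is a constant $c>0$, depending only on $\sigma_{\min},\sigma_{\max},a$, such that the following holds for every $\alpha\in(0,1)$, all integers $n,d$, all $C_{\rm x},C_1>0$ and every probability distribution $Q$ on $\mathbb{R}^d$ with $\mathbb{E}_{X\sim Q}\|X\|_2^2<C_{\rm x}^2$. **Model.** For $\theta\in\mathbb{R}^d$ and $\sigma>0$ let $P_{\theta,\sigma}$ be the law of $(Y,X)$ with $Y=X^\top\theta+\epsilon$, where $X\sim Q$ and $\epsilon\sim N(0,\sigma^2)$ are independent, and let $$p_{\theta,\sigma}(y,x)=\frac{1}{\sqrt{2\pi\sigma^2}}\exp\Big(-\frac{(y-x^\top\theta)^2}{2\sigma^2}\Big)$$ be its density with respect to (Lebesgue measure) $\otimes\, Q$. Let $\theta_0\in\mathbb{R}^d$ and $\sigma_0>0$ satisfy $(2\sigma_{\min})^{-1}<\sigma_0^2<(2\sigma_{\max})^{-1}$, let $s^*=\|\theta_0\|_0$ be the number of nonzero entries of $\theta_0$, and assume $1\le s^*<n<d$. The observations $Z_i=(Y_i,X_i)$, $i=1,\dots,n$, are i.i.d. with law $P_{\theta_0,\sigma_0}$.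 **Prior and fractional posterior.** Put $\tau=\frac{1}{C_{\rm x}\sqrt{nd}}$ and $b=n^{-1/2}$, and assume $\|\theta_0\|_1\le C_1-2d\tau$. Under the prior $\pi$, $\theta$ and $\sigma$ are independent, $\theta$ has Lebesgue density proportional to $\prod_{i=1}^d(\tau^2+\theta_i^2)^{-2}$ on $\{\theta:\|\theta\|_1\le C_1\}$ (and zero outside), and $\sigma^2$ has the inverse-Gamma law with shape $a$ and scale $b$. The fractional posterior is the probability measure $$\Pi_{n,\alpha}({\rm d}\theta,{\rm d}\sigma)\propto\Big(\prod_{i=1}^n p_{\theta,\sigma}(Y_i,X_i)\Big)^{\alpha}\,\pi({\rm d}\theta,{\rm d}\sigma).$$ **Conclusion.** Let $D_\alpha(P,R)=\frac{1}{\alpha-1}\log\int\big(\frac{{\rm d}P}{{\rm d}\mu}\big)^\alpha\big(\frac{{\rm d}R}{{\rm d}\mu}\big)^{1-\alpha}{\rm d}\mu$ (for any $\mu$ dominating $P$ and $R$) be the $\alpha$-Rényi divergence, and let $$\varepsilon_n=\frac{c\,s^*}{n}\log\Big(\frac{C_{\rm x}C_1\sqrt{nd}}{s^*}\Big).$$ Then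 $$\mathbb{P}\left[\int D_\alpha(P_{\theta,\sigma},P_{\theta_0,\sigma_0})\,\Pi_{n,\alpha}({\rm d}\theta,{\rm d}\sigma)\le\frac{2(\alpha+1)}{1-\alpha}\,\varepsilon_n\right]\ge 1-\frac{2}{n\varepsilon_n}.$$ -/

import Mathlib

open MeasureTheory ProbabilityTheory
open scoped ENNReal NNReal

namespace FracPosterior

noncomputable section

/-- The covariate / coefficient space `ℝ^d` with its Euclidean structure. -/
abbrev Vec (d : ℕ) : Type := EuclideanSpace ℝ (Fin d)

/-- The `ℓ₁`-norm on `ℝ^d`. -/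
def l1norm {d : ℕ} (θ : Vec d) : ℝ := ∑ i, |θ i|

/-- The `ℓ₀` quasi-norm: the number of nonzero entries. -/
def l0norm {d : ℕ} (θ : Vec d) : ℕ := (Finset.univ.filter fun i => θ i ≠ 0).card

/-- The measure `ν` divided by its total mass; this is a probability measure as soon as
`0 < ν univ < ∞`. -/
def normalize {Ω : Type*} [MeasurableSpace Ω] (ν : Measure Ω) : Measure Ω :=
  (ν Set.univ)⁻¹ • ν

/-- The `α`-Rényi divergence
`D_α(P,R) = (α - 1)⁻¹ log ∫ (dP/dμ)^α (dR/dμ)^(1-α) dμ`, computed with the dominating measure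
`μ = P + R`. It takes values in the extended reals (`+∞` when `P` and `R` are mutually singular
and `α < 1`). -/
def renyiDiv {Ω : Type*} [MeasurableSpace Ω] (α : ℝ) (P R : Measure Ω) : EReal :=
  (((α - 1)⁻¹ : ℝ) : EReal) *
    ENNReal.log (∫⁻ ω, P.rnDeriv (P + R) ω ^ α * R.rnDeriv (P + R) ω ^ (1 - α) ∂(P + R))

/-- The law `P_{θ,σ}` of one observation `Z = (Y, X)`, where `Y = Xᵀθ + ε`, the covariate `X` has
law `Q`, and `ε ∼ N(0, σ²)` is independent of `X`. -/
def modelLaw {d : ℕ} (Q : Measure (Vec d)) (θ : Vec d) (σ : ℝ) : Measure (ℝ × Vec d) :=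
  (Q.prod (gaussianReal 0 (σ ^ 2).toNNReal)).map fun p => (inner ℝ p.1 θ + p.2, p.1)

/-- The density `p_{θ,σ}(y, x)` of `P_{θ,σ}` with respect to the product of Lebesgue measure and the
law of the covariate, a dominating measure that is common to all parameters. -/
def modelDensity {d : ℕ} (θ : Vec d) (σ : ℝ) (z : ℝ × Vec d) : ℝ :=
  gaussianPDFReal (inner ℝ z.2 θ) (σ ^ 2).toNNReal z.1

/-- The likelihood `L_n(θ,σ) = ∏ᵢ p_{θ,σ}(Yᵢ, Xᵢ)` of a sample `z`. -/
def likelihood {n d : ℕ} (z : Fin n → ℝ × Vec d) (θ : Vec d) (σ : ℝ) : ℝ :=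
  ∏ i, modelDensity θ σ (z i)

/-- The scaled Student prior on the `ℓ₁`-ball of radius `C₁`: its Lebesgue density is proportional to
`∏ᵢ (τ² + θᵢ²)⁻²` on the ball, and zero outside. -/
def thetaPrior (d : ℕ) (τ C₁ : ℝ) : Measure (Vec d) :=
  normalize ((volume.restrict {θ : Vec d | l1norm θ ≤ C₁}).withDensity fun θ =>
    ENNReal.ofReal (∏ i, ((τ ^ 2 + θ i ^ 2) ^ 2)⁻¹))

/-- The prior on `σ` for which `σ² ∼ IG(a, b)`: the inverse-Gamma law of shape `a` and scale `b` is
the law of `G⁻¹` for `G` of Gamma law with shape `a` and rate `b`. -/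
def sigmaPrior (a b : ℝ) : Measure ℝ :=
  (gammaMeasure a b).map fun g => Real.sqrt g⁻¹

/-- The product prior on `(θ, σ)`. -/
def prior (d : ℕ) (τ C₁ a b : ℝ) : Measure (Vec d × ℝ) :=
  (thetaPrior d τ C₁).prod (sigmaPrior a b)

/-- The fractional posterior `Π_{n,α}(dθ, dσ) ∝ L_n(θ,σ)^α π(dθ, dσ)` given the sample `z`, for a
prior `π`. -/
def fracPosterior {n d : ℕ} (α : ℝ) (π : Measure (Vec d × ℝ)) (z : Fin n → ℝ × Vec d) :
    Measure (Vec d × ℝ) :=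
  normalize (π.withDensity fun p => ENNReal.ofReal (likelihood z p.1 p.2 ^ α))

end

/-- Between probability measures the Rényi divergence of order `α ∈ (0,1)` is nonnegative. -/
theorem renyiDiv_nonneg {Ω : Type*} [MeasurableSpace Ω] {α : ℝ} (h0 : 0 < α) (h1 : α < 1)
    (P R : Measure Ω) [IsProbabilityMeasure P] [IsProbabilityMeasure R] :
    0 ≤ renyiDiv α P R := by
  have hle : ∫⁻ ω, P.rnDeriv (P + R) ω ^ α * R.rnDeriv (P + R) ω ^ (1 - α) ∂(P + R) ≤ 1 := by
    refine (ENNReal.lintegral_mul_norm_pow_le (Measure.measurable_rnDeriv _ _).aemeasurable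
      (Measure.measurable_rnDeriv _ _).aemeasurable h0.le (by linarith) (by ring)).trans ?_
    have e1 := Measure.lintegral_rnDeriv_le (μ := P) (ν := P + R)
    have e2 := Measure.lintegral_rnDeriv_le (μ := R) (ν := P + R)
    rw [measure_univ] at e1 e2
    calc _ ≤ (1 : ℝ≥0∞) ^ α * 1 ^ (1 - α) := by
          gcongr
      _ = 1 := by simp
  unfold renyiDiv
  refine EReal.mul_nonneg_iff.2 (Or.inr ⟨?_, ENNReal.log_le_zero_iff.2 hle⟩)
  have : (α - 1)⁻¹ ≤ 0 := inv_nonpos.2 (by linarith)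
  exact_mod_cast this

/-- The Rényi divergence may be computed with any dominating measure. -/
theorem renyiDiv_eq {Ω : Type*} [MeasurableSpace Ω] {α : ℝ} (h0 : 0 < α) (h1 : α < 1)
    (P R μ : Measure Ω) [IsProbabilityMeasure P] [IsProbabilityMeasure R] [SigmaFinite μ]
    (hP : P ≪ μ) (hR : R ≪ μ) :
    renyiDiv α P R = (((α - 1)⁻¹ : ℝ) : EReal) *
      ENNReal.log (∫⁻ ω, P.rnDeriv μ ω ^ α * R.rnDeriv μ ω ^ (1 - α) ∂μ) := by
  have hS : P + R ≪ μ := hP.add_left hR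
  have hPS : P ≪ P + R := Measure.AbsolutelyContinuous.rfl.add_right R
  have hRS : R ≪ P + R := by
    rw [add_comm]
    exact Measure.AbsolutelyContinuous.rfl.add_right P
  unfold renyiDiv
  congr 2
  rw [← lintegral_rnDeriv_mul hS (by fun_prop)]
  refine lintegral_congr_ae ?_
  filter_upwards [Measure.rnDeriv_mul_rnDeriv hPS (κ := μ),
    Measure.rnDeriv_mul_rnDeriv hRS (κ := μ)] with ω e1 e2
  rw [← e1, ← e2]
  simp only [Pi.mul_apply]
  rw [ENNReal.mul_rpow_of_nonneg _ _ h0.le, ENNReal.mul_rpow_of_nonneg _ _ (by linarith)]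
  have : (P + R).rnDeriv μ ω = (P + R).rnDeriv μ ω ^ α * (P + R).rnDeriv μ ω ^ (1 - α) := by
    rw [← ENNReal.rpow_add_of_nonneg _ _ h0.le (by linarith)]
    simp
  nth_rw 1 [this]
  ring

/-- `modelDensity` is a density of the law of one observation. -/
theorem modelLaw_eq_withDensity {d : ℕ} (Q : Measure (Vec d)) [IsProbabilityMeasure Q]
    (θ : Vec d) {σ : ℝ} (hσ : 0 < σ) :
    modelLaw Q θ σ =
      (volume.prod Q).withDensity fun z => ENNReal.ofReal (modelDensity θ σ z) := by
  have hv : (σ ^ 2).toNNReal ≠ 0 := by simpa using hσ.ne'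
  have hmd : Measurable fun z : ℝ × Vec d => ENNReal.ofReal (modelDensity θ σ z) := by
    unfold modelDensity gaussianPDFReal
    fun_prop
  have hmf : Measurable fun p : Vec d × ℝ => (inner ℝ p.1 θ + p.2, p.1) := by fun_prop
  refine Measure.ext fun s hs => ?_
  rw [modelLaw, Measure.map_apply hmf hs, Measure.prod_apply (hmf hs), withDensity_apply _ hs,
    ← lintegral_indicator hs, lintegral_prod_symm _ (hmd.indicator hs).aemeasurable]
  refine lintegral_congr fun x => ?_
  have hsx : MeasurableSet {y : ℝ | (y, x) ∈ s} := measurable_prodMk_right hs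
  have e : Prod.mk x ⁻¹' ((fun p : Vec d × ℝ => (inner ℝ p.1 θ + p.2, p.1)) ⁻¹' s)
      = (fun y => inner ℝ x θ + y) ⁻¹' {y : ℝ | (y, x) ∈ s} := rfl
  rw [e, ← Measure.map_apply (by fun_prop) hsx, gaussianReal_map_const_add,
    gaussianReal_of_var_ne_zero _ hv, withDensity_apply _ hsx, ← lintegral_indicator hsx]
  refine lintegral_congr fun y => ?_
  simp [Set.indicator, gaussianPDF, modelDensity]

theorem isProbabilityMeasure_normalize {Ω : Type*} [MeasurableSpace Ω] {ν : Measure Ω}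
    (h0 : ν Set.univ ≠ 0) (h1 : ν Set.univ ≠ ∞) : IsProbabilityMeasure (normalize ν) :=
  ⟨by simp [normalize, ENNReal.inv_mul_cancel h0 h1]⟩

theorem isProbabilityMeasure_thetaPrior (d : ℕ) {τ C₁ : ℝ} (hτ : 0 < τ) (hC : 0 < C₁) :
    IsProbabilityMeasure (thetaPrior d τ C₁) := by
  have hc : Continuous (l1norm (d := d)) := by unfold l1norm; fun_prop
  have hms : MeasurableSet {θ : Vec d | l1norm θ ≤ C₁} := measurableSet_le hc.measurable measurable_const
  have hmd : Measurable fun θ : Vec d => ENNReal.ofReal (∏ i, ((τ ^ 2 + θ i ^ 2) ^ 2)⁻¹) := by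
    fun_prop
  have hbd : {θ : Vec d | l1norm θ ≤ C₁} ⊆ Metric.closedBall 0 C₁ := by
    intro θ hθ
    rw [mem_closedBall_zero_iff, EuclideanSpace.norm_eq]
    refine (Real.sqrt_le_left hC.le).2 ?_ 
    have h1 : ∑ i, ‖θ i‖ ^ 2 ≤ (l1norm θ) ^ 2 := by
      unfold l1norm
      exact Finset.sum_sq_le_sq_sum_of_nonneg (fun i _ => abs_nonneg _)
    have h2 : 0 ≤ l1norm θ := Finset.sum_nonneg fun i _ => abs_nonneg _
    exact h1.trans (by gcongr; exact hθ)
  apply isProbabilityMeasure_normalize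
  · rw [withDensity_apply _ MeasurableSet.univ, Measure.restrict_univ]
    intro h
    rw [lintegral_eq_zero_iff hmd] at h
    have h2 : ∀ᵐ θ : Vec d ∂(volume.restrict {θ : Vec d | l1norm θ ≤ C₁}), False := by
      filter_upwards [h] with θ hθ
      have : 0 < ∏ i, ((τ ^ 2 + θ i ^ 2) ^ 2)⁻¹ := Finset.prod_pos fun i _ => by positivity
      exact absurd hθ (by simpa using this)
    rw [Filter.eventually_false_iff_eq_bot, ae_eq_bot, Measure.restrict_eq_zero] at h2
    have hU : IsOpen {θ : Vec d | l1norm θ < C₁} := isOpen_lt hc continuous_const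
    have := hU.measure_pos volume ⟨0, by simp [l1norm, hC]⟩
    exact this.ne' (measure_mono_null (fun θ (h : l1norm θ < C₁) => h.le) h2)
  · rw [withDensity_apply _ MeasurableSet.univ, Measure.restrict_univ]
    have : ∀ θ : Vec d, ENNReal.ofReal (∏ i, ((τ ^ 2 + θ i ^ 2) ^ 2)⁻¹)
        ≤ ENNReal.ofReal (∏ i : Fin d, ((τ ^ 2) ^ 2)⁻¹) := by
      intro θ
      apply ENNReal.ofReal_le_ofReal
      apply Finset.prod_le_prod (fun i _ => by positivity)
      intro i _
      gcongr
      nlinarith [sq_nonneg (θ i)]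
    refine ((lintegral_mono this).trans_lt ?_).ne
    rw [lintegral_const]
    refine ENNReal.mul_lt_top ENNReal.ofReal_lt_top ?_
    rw [Measure.restrict_apply_univ]
    exact (measure_mono hbd).trans_lt measure_closedBall_lt_top

theorem isProbabilityMeasure_sigmaPrior {a b : ℝ} (ha : 0 < a) (hb : 0 < b) :
    IsProbabilityMeasure (sigmaPrior a b) := by
  have := isProbabilityMeasure_gammaMeasure ha hb
  exact Measure.isProbabilityMeasure_map (by fun_prop)

theorem sigmaPrior_pos {a b : ℝ} : ∀ᵐ σ ∂(sigmaPrior a b), 0 < σ := by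
  unfold sigmaPrior
  rw [ae_map_iff (by fun_prop) measurableSet_Ioi]
  unfold gammaMeasure
  rw [ae_withDensity_iff
    (show Measurable (gammaPDF a b) from (measurable_gammaPDFReal a b).ennreal_ofReal)]
  have : ∀ᵐ x : ℝ, x ≠ 0 := by simp [ae_iff]
  filter_upwards [this] with x hx h
  have : 0 ≤ x := by
    by_contra hn
    exact h (gammaPDF_of_neg (not_le.1 hn))
  have : 0 < x := lt_of_le_of_ne this hx.symm
  positivity

theorem lintegral_sigmaPrior_lt_top {a b : ℝ} (ha : 0 < a) (hb : 0 < b) (n : ℕ) :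
    ∫⁻ σ, ENNReal.ofReal ((1 + (σ ^ 2)⁻¹) ^ n) ∂(sigmaPrior a b) < ∞ := by
  unfold sigmaPrior gammaMeasure
  rw [lintegral_map (by fun_prop) (by fun_prop), lintegral_withDensity_eq_lintegral_mul _
    (show Measurable (gammaPDF a b) from (measurable_gammaPDFReal a b).ennreal_ofReal)
    (by fun_prop)]
  set K : ℝ := n.factorial * (2 / b) ^ n * Real.exp (b / 2) * 2 ^ a
  have hK : 0 ≤ K := by positivity
  have key : ∀ g : ℝ, (gammaPDF a b * fun g => ENNReal.ofReal ((1 + (√g⁻¹ ^ 2)⁻¹) ^ n)) g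
      ≤ ENNReal.ofReal K * gammaPDF a (b / 2) g := by
    intro g
    rcases lt_or_ge g 0 with hg | hg
    · simp [gammaPDF_of_neg hg]
    · simp only [Pi.mul_apply]
      rw [gammaPDF_of_nonneg hg, gammaPDF_of_nonneg hg, ← ENNReal.ofReal_mul (by positivity),
        ← ENNReal.ofReal_mul hK]
      apply ENNReal.ofReal_le_ofReal
      rw [Real.sq_sqrt (by positivity), inv_inv]
      have h1 := Real.pow_div_factorial_le_exp (b / 2 * (1 + g)) (by positivity) n
      rw [div_le_iff₀ (by positivity), mul_pow] at h1
      have h2 : (1 + g) ^ n ≤ (2 / b) ^ n * (Real.exp (b / 2 * (1 + g)) * n.factorial) := by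
        calc (1 + g) ^ n = (2 / b) ^ n * ((b / 2) ^ n * (1 + g) ^ n) := by
              rw [← mul_assoc, ← mul_pow, div_mul_div_cancel₀ hb.ne',
                div_self two_ne_zero, one_pow, one_mul]
          _ ≤ _ := by gcongr
      have e1 : Real.exp (b / 2 * (1 + g)) * Real.exp (-(b * g))
          = Real.exp (b / 2) * Real.exp (-(b / 2 * g)) := by
        rw [← Real.exp_add, ← Real.exp_add]; ring_nf
      have e2 : b ^ a = 2 ^ a * (b / 2) ^ a := by
        rw [← Real.mul_rpow (by positivity) (by positivity)]; congr 1; ring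
      have hG := Real.Gamma_pos_of_pos ha
      calc _ ≤ b ^ a / Real.Gamma a * g ^ (a - 1) * Real.exp (-(b * g)) *
            ((2 / b) ^ n * (Real.exp (b / 2 * (1 + g)) * n.factorial)) := by gcongr
        _ = b ^ a / Real.Gamma a * g ^ (a - 1) * (2 / b) ^ n * n.factorial *
            (Real.exp (b / 2 * (1 + g)) * Real.exp (-(b * g))) := by ring
        _ = _ := by rw [e1, e2]; ring
  refine (lintegral_mono key).trans_lt ?_
  rw [lintegral_const_mul' _ _ ENNReal.ofReal_ne_top, lintegral_gammaPDF_eq_one ha (by positivity)]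
  simp

theorem modelDensity_le {d : ℕ} (θ : Vec d) {σ : ℝ} (hσ : 0 < σ) (z : ℝ × Vec d) :
    modelDensity θ σ z ≤ 1 + (σ ^ 2)⁻¹ := by
  unfold modelDensity gaussianPDFReal
  rw [Real.coe_toNNReal _ (sq_nonneg σ)]
  have h1 : Real.exp (-(z.1 - inner ℝ z.2 θ) ^ 2 / (2 * σ ^ 2)) ≤ 1 := by
    rw [Real.exp_le_one_iff]
    exact div_nonpos_of_nonpos_of_nonneg (by nlinarith [sq_nonneg (z.1 - inner ℝ z.2 θ)])
      (by positivity)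
  have h2 : (√(2 * Real.pi * σ ^ 2))⁻¹ ≤ σ⁻¹ := by
    gcongr
    apply Real.le_sqrt_of_sq_le
    nlinarith [Real.pi_gt_three, sq_nonneg σ]
  have h3 : σ⁻¹ ≤ 1 + (σ ^ 2)⁻¹ := by
    rw [← inv_pow]
    nlinarith [sq_nonneg (σ⁻¹ - 1), sq_nonneg σ⁻¹]
  calc _ ≤ (√(2 * Real.pi * σ ^ 2))⁻¹ * 1 := by gcongr
    _ ≤ _ := by linarith

/-- The fractional posterior is a probability measure, for every sample. -/
theorem isProbabilityMeasure_fracPosterior {n d : ℕ} {α τ C₁ a b : ℝ} (h0 : 0 < α) (h1 : α < 1)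
    (hτ : 0 < τ) (hC : 0 < C₁) (ha : 0 < a) (hb : 0 < b) (z : Fin n → ℝ × Vec d) :
    IsProbabilityMeasure (fracPosterior α (prior d τ C₁ a b) z) := by
  have := isProbabilityMeasure_thetaPrior d hτ hC
  have := isProbabilityMeasure_sigmaPrior ha hb
  have hpos : ∀ᵐ p ∂(prior d τ C₁ a b), 0 < p.2 :=
    Measure.quasiMeasurePreserving_snd.ae sigmaPrior_pos
  have hm : Measurable fun p : Vec d × ℝ => ENNReal.ofReal (likelihood z p.1 p.2 ^ α) := by
    unfold likelihood modelDensity gaussianPDFReal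
    fun_prop
  have hlpos : ∀ p : Vec d × ℝ, 0 < p.2 → 0 < likelihood z p.1 p.2 := fun p hp =>
    Finset.prod_pos fun i _ => gaussianPDFReal_pos _ _ _ (by simpa using hp.ne')
  apply isProbabilityMeasure_normalize
  · rw [withDensity_apply _ MeasurableSet.univ, Measure.restrict_univ]
    intro h
    rw [lintegral_eq_zero_iff hm] at h
    have : ∀ᵐ p ∂(prior d τ C₁ a b), False := by
      filter_upwards [h, hpos] with p hp hp2
      have := Real.rpow_pos_of_pos (hlpos p hp2) α
      simp at hp
      linarith
    rw [Filter.eventually_false_iff_eq_bot, ae_eq_bot] at this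
    have h3 : IsProbabilityMeasure (prior d τ C₁ a b) := by unfold prior; infer_instance
    rw [this] at h3
    exact zero_ne_one (show (0 : ℝ≥0∞) = 1 from h3.measure_univ)
  · rw [withDensity_apply _ MeasurableSet.univ, Measure.restrict_univ]
    have hle : ∀ᵐ p ∂(prior d τ C₁ a b), ENNReal.ofReal (likelihood z p.1 p.2 ^ α) ≤
        ENNReal.ofReal ((1 + (p.2 ^ 2)⁻¹) ^ n) := by
      filter_upwards [hpos] with p hp
      apply ENNReal.ofReal_le_ofReal
      have hl : likelihood z p.1 p.2 ≤ (1 + (p.2 ^ 2)⁻¹) ^ n := by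
        unfold likelihood
        calc _ ≤ ∏ _i : Fin n, (1 + (p.2 ^ 2)⁻¹) :=
              Finset.prod_le_prod (fun i _ => gaussianPDFReal_nonneg _ _ _)
                (fun i _ => modelDensity_le _ hp _)
          _ = _ := by simp
      have h1' : 1 ≤ (1 + (p.2 ^ 2)⁻¹) ^ n := one_le_pow₀ (by simp; positivity)
      calc _ ≤ ((1 + (p.2 ^ 2)⁻¹) ^ n) ^ α := Real.rpow_le_rpow (hlpos p hp).le hl h0.le
        _ ≤ ((1 + (p.2 ^ 2)⁻¹) ^ n) ^ (1 : ℝ) := Real.rpow_le_rpow_of_exponent_le h1' h1.le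
        _ = _ := Real.rpow_one _
    refine ((lintegral_mono_ae hle).trans_lt ?_).ne
    unfold prior
    rw [lintegral_prod _ (by fun_prop)]
    simp only [lintegral_const, measure_univ, mul_one]
    exact lintegral_sigmaPrior_lt_top ha hb n

end FracPosterior

/-! The argument is of PAC-Bayes type. Let A be the affinity ∫ (p_{θ,σ}/p₀)^α dP₀ of a parameter
with the truth, so that D_α = -(1-α)⁻¹ log A, and let L, L₀ be the likelihoods at the parameter and
at the truth. By independence, (L/L₀)^α A⁻ⁿ has mean at most one for each fixed parameter, hence so
has its prior integral V (`lintegral_normalized_prod_le_one`). Jensen's inequality under the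
posterior then bounds n(1-α) ∫ D_α dΠ by the logarithm of V over the relative evidence ∫ (L/L₀)^α dπ
(`lintegral_normalize_le_of_exp_le`).

The evidence is bounded below by localising the prior. Up to a factor κ, the prior on θ dominates
the law of θ₀ + δ, where δ is symmetric with small second moments (`exists_local_prior`); σ is
confined to precisions between σ₀⁻² and (1 + 1/n)σ₀⁻². Jensen's inequality in δ moves the average
into the exponent, and symmetry kills the term linear in δ. What remains is a sum of nonnegative
`excess` terms whose total mean is at most one, because τ²C_x²nd = 1. Hence Markov's inequality for
V and for the total excess, at level R = nε, suffices and gives the failure probability 2/R. Off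
these events the logarithm is at most log(R e^R e^{αR}) ≤ 2(α+1)R.

The constant c is chosen so that the two localisation factors multiply to at least e^{-R}. The
polynomial tails of the Student density make a nonzero coordinate cost about 4 log(2 + |θ₀ᵢ|/τ).
Concavity of the logarithm sums this over the support to at most 4 s* log(C₁/(τs*))
(`localization_cost_le`), and the window for σ costs a multiple of log n, which is absorbed. -/

namespace FracPosterior

/-! ### Moments of the scaled Student density -/

open Filter Topology in
theorem tendsto_div_sq_add_sq (τ : ℝ) :
    Tendsto (fun t : ℝ => t / (τ ^ 2 + t ^ 2)) (cocompact ℝ) (𝓝 0) := by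
  have h1 : Tendsto (fun t : ℝ => ‖t‖⁻¹) (cocompact ℝ) (𝓝 0) :=
    tendsto_inv_atTop_zero.comp tendsto_norm_cocompact_atTop
  refine squeeze_zero_norm (fun t => ?_) h1
  rcases eq_or_ne t 0 with rfl | ht
  · simp
  have ht' : 0 < |t| := abs_pos.2 ht
  rw [norm_div, Real.norm_eq_abs, Real.norm_eq_abs, abs_of_nonneg (by positivity : 0 ≤ τ ^ 2 + t ^ 2),
    div_le_iff₀ (by positivity), ← sq_abs t]
  field_simp
  nlinarith [sq_nonneg τ]

/-- The primitive vanishes at ±∞, so integrating this identity expresses the Student normalising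
constant through the Cauchy integral π/τ. -/
theorem hasDerivAt_div_sq_add_sq {τ : ℝ} (hτ : 0 < τ) (t : ℝ) :
    HasDerivAt (fun t : ℝ => t / (τ ^ 2 + t ^ 2))
      (2 * τ ^ 2 * ((τ ^ 2 + t ^ 2) ^ 2)⁻¹ - (τ ^ 2 + t ^ 2)⁻¹) t := by
  have h0 : τ ^ 2 + t ^ 2 ≠ 0 := by positivity
  have h1 : HasDerivAt (fun t : ℝ => τ ^ 2 + t ^ 2) (2 * t) t := by
    simpa using (hasDerivAt_pow 2 t).const_add (τ ^ 2)
  convert! (hasDerivAt_id' t).div h1 h0 using 1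
  field_simp
  ring

theorem integrable_inv_sq_add_sq {τ : ℝ} (hτ : 0 < τ) :
    Integrable fun t : ℝ => (τ ^ 2 + t ^ 2)⁻¹ := by
  have h := (integrable_inv_one_add_sq.comp_div hτ.ne').const_mul (τ ^ 2)⁻¹
  refine h.congr (ae_of_all _ fun t => ?_)
  simp only
  rw [← mul_inv]
  congr 1
  field_simp

theorem integral_inv_sq_add_sq {τ : ℝ} (hτ : 0 < τ) :
    ∫ t : ℝ, (τ ^ 2 + t ^ 2)⁻¹ = Real.pi / τ := by
  have h : ∀ t : ℝ, (τ ^ 2 + t ^ 2)⁻¹ = (τ ^ 2)⁻¹ * (1 + (t / τ) ^ 2)⁻¹ := fun t => by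
    rw [← mul_inv]
    congr 1
    field_simp
  simp_rw [h]
  rw [integral_const_mul, Measure.integral_comp_div (fun t : ℝ => (1 + t ^ 2)⁻¹),
    integral_univ_inv_one_add_sq, abs_of_pos hτ, smul_eq_mul]
  field_simp

theorem integrable_student {τ : ℝ} (hτ : 0 < τ) :
    Integrable fun t : ℝ => ((τ ^ 2 + t ^ 2) ^ 2)⁻¹ := by
  refine ((integrable_inv_sq_add_sq hτ).const_mul (τ ^ 2)⁻¹).mono'
    (by fun_prop) (ae_of_all _ fun t => ?_)
  rw [Real.norm_of_nonneg (by positivity), ← mul_inv]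
  gcongr
  nlinarith [mul_nonneg (sq_nonneg τ) (sq_nonneg t), sq_nonneg (t ^ 2)]

theorem integral_student {τ : ℝ} (hτ : 0 < τ) :
    ∫ t : ℝ, ((τ ^ 2 + t ^ 2) ^ 2)⁻¹ = Real.pi / (2 * τ ^ 3) := by
  have h := integral_of_hasDerivAt_of_tendsto (hasDerivAt_div_sq_add_sq hτ)
    (((integrable_student hτ).const_mul _).sub (integrable_inv_sq_add_sq hτ))
    ((tendsto_div_sq_add_sq τ).mono_left atBot_le_cocompact)
    ((tendsto_div_sq_add_sq τ).mono_left atTop_le_cocompact)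
  rw [integral_sub ((integrable_student hτ).const_mul _) (integrable_inv_sq_add_sq hτ),
    integral_const_mul, integral_inv_sq_add_sq hτ] at h
  have h2 : 2 * τ ^ 2 * ∫ t : ℝ, ((τ ^ 2 + t ^ 2) ^ 2)⁻¹ = Real.pi / τ := by linarith
  rw [eq_div_iff (by positivity)]
  rw [eq_div_iff hτ.ne'] at h2
  linarith

theorem sq_mul_student_eq {τ : ℝ} (hτ : 0 < τ) (t : ℝ) :
    t ^ 2 * ((τ ^ 2 + t ^ 2) ^ 2)⁻¹ =
      (τ ^ 2 + t ^ 2)⁻¹ - τ ^ 2 * ((τ ^ 2 + t ^ 2) ^ 2)⁻¹ := by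
  have h0 : τ ^ 2 + t ^ 2 ≠ 0 := by positivity
  field_simp
  ring

theorem integrable_sq_mul_student {τ : ℝ} (hτ : 0 < τ) :
    Integrable fun t : ℝ => t ^ 2 * ((τ ^ 2 + t ^ 2) ^ 2)⁻¹ := by
  simp_rw [sq_mul_student_eq hτ]
  exact (integrable_inv_sq_add_sq hτ).sub ((integrable_student hτ).const_mul _)

theorem integral_sq_mul_student {τ : ℝ} (hτ : 0 < τ) :
    ∫ t : ℝ, t ^ 2 * ((τ ^ 2 + t ^ 2) ^ 2)⁻¹ = τ ^ 2 * (Real.pi / (2 * τ ^ 3)) := by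
  simp_rw [sq_mul_student_eq hτ]
  rw [integral_sub (integrable_inv_sq_add_sq hτ) ((integrable_student hτ).const_mul _),
    integral_const_mul, integral_student hτ, integral_inv_sq_add_sq hτ]
  field_simp
  ring

/-! ### Products of symmetric densities on the line -/

/-- A symmetric probability density on the line whose second moment is at most `m`. -/
structure IsSymmDensity (f : ℝ → ℝ) (m : ℝ) : Prop where
  nonneg : ∀ t, 0 ≤ f t
  measurable : Measurable f
  even : ∀ t, f (-t) = f t
  integrable : Integrable f
  integral_eq : ∫ t, f t = 1
  integrable_sq : Integrable fun t => t ^ 2 * f t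
  integral_sq_le : ∫ t, t ^ 2 * f t ≤ m

theorem isSymmDensity_student {τ : ℝ} (hτ : 0 < τ) :
    IsSymmDensity (fun t => (Real.pi / (2 * τ ^ 3))⁻¹ * ((τ ^ 2 + t ^ 2) ^ 2)⁻¹) (τ ^ 2) := by
  have hpi := Real.pi_pos
  have e : (fun t : ℝ => t ^ 2 * ((Real.pi / (2 * τ ^ 3))⁻¹ * ((τ ^ 2 + t ^ 2) ^ 2)⁻¹)) =
      fun t : ℝ => (Real.pi / (2 * τ ^ 3))⁻¹ * (t ^ 2 * ((τ ^ 2 + t ^ 2) ^ 2)⁻¹) := by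
    ext t
    ring
  refine ⟨fun t => by positivity, by fun_prop, fun t => by simp, (integrable_student hτ).const_mul _,
    ?_, ?_, ?_⟩
  · rw [integral_const_mul, integral_student hτ, inv_mul_cancel₀ (by positivity)]
  · rw [e]
    exact (integrable_sq_mul_student hτ).const_mul _
  · rw [e, integral_const_mul, integral_sq_mul_student hτ]
    field_simp
    rfl

theorem isSymmDensity_uniform {r : ℝ} (hr : 0 < r) :
    IsSymmDensity (Set.indicator (Set.Icc (-r) r) fun _ => (2 * r)⁻¹) (r ^ 2) := by
  have hint : Integrable (Set.indicator (Set.Icc (-r) r) fun _ : ℝ => (2 * r)⁻¹) :=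
    (integrable_indicator_iff measurableSet_Icc).2 (integrableOn_const (by simp))
  have h1 : ∫ t, Set.indicator (Set.Icc (-r) r) (fun _ : ℝ => (2 * r)⁻¹) t = 1 := by
    rw [integral_indicator measurableSet_Icc, setIntegral_const, Real.volume_real_Icc,
      max_eq_left (by linarith), smul_eq_mul]
    field_simp
    ring
  have hle : ∀ t, t ^ 2 * Set.indicator (Set.Icc (-r) r) (fun _ : ℝ => (2 * r)⁻¹) t ≤
      r ^ 2 * Set.indicator (Set.Icc (-r) r) (fun _ : ℝ => (2 * r)⁻¹) t := by
    intro t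
    by_cases ht : t ∈ Set.Icc (-r) r
    · rw [Set.indicator_of_mem ht]
      gcongr ?_ * _
      exact sq_le_sq' ht.1 ht.2
    · simp [Set.indicator_of_notMem ht]
  have hm : Measurable (Set.indicator (Set.Icc (-r) r) fun _ : ℝ => (2 * r)⁻¹) :=
    measurable_const.indicator measurableSet_Icc
  have hnn : ∀ t, 0 ≤ Set.indicator (Set.Icc (-r) r) (fun _ : ℝ => (2 * r)⁻¹) t := fun t =>
    Set.indicator_nonneg (fun _ _ => by positivity) t
  have hsq : Integrable fun t => t ^ 2 * Set.indicator (Set.Icc (-r) r) (fun _ : ℝ => (2 * r)⁻¹) t := by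
    refine (hint.const_mul (r ^ 2)).mono' (by fun_prop) (ae_of_all _ fun t => ?_)
    rw [Real.norm_of_nonneg (mul_nonneg (sq_nonneg t) (hnn t))]
    exact hle t
  refine ⟨hnn, hm, fun t => ?_, hint, h1, hsq, ?_⟩
  · have : -t ∈ Set.Icc (-r) r ↔ t ∈ Set.Icc (-r) r := by
      simp only [Set.mem_Icc]
      constructor <;> rintro ⟨h, h'⟩ <;> constructor <;> linarith
    by_cases ht : t ∈ Set.Icc (-r) r
    · rw [Set.indicator_of_mem ht, Set.indicator_of_mem (this.2 ht)]
    · rw [Set.indicator_of_notMem ht, Set.indicator_of_notMem (mt this.1 ht)]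
  · refine (integral_mono hsq (hint.const_mul _) hle).trans ?_
    rw [integral_const_mul, h1, mul_one]

/-- The probability measure on the line with density `f`. -/
noncomputable def lineMeasure (f : ℝ → ℝ) : Measure ℝ :=
  volume.withDensity fun t => ENNReal.ofReal (f t)

namespace IsSymmDensity

variable {f : ℝ → ℝ} {m : ℝ}

theorem isProbabilityMeasure (hf : IsSymmDensity f m) : IsProbabilityMeasure (lineMeasure f) := by
  constructor
  rw [lineMeasure, withDensity_apply _ MeasurableSet.univ, Measure.restrict_univ,
    ← ofReal_integral_eq_lintegral_ofReal hf.integrable (ae_of_all _ hf.nonneg), hf.integral_eq,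
    ENNReal.ofReal_one]

theorem integral_lineMeasure (hf : IsSymmDensity f m) (g : ℝ → ℝ) :
    ∫ t, g t ∂(lineMeasure f) = ∫ t, g t * f t := by
  rw [lineMeasure, integral_withDensity_eq_integral_toReal_smul
    (hf.measurable.ennreal_ofReal) (by simp)]
  refine integral_congr_ae (ae_of_all _ fun t => ?_)
  simp only [smul_eq_mul]
  rw [ENNReal.toReal_ofReal (hf.nonneg t), mul_comm]

theorem memLp (hf : IsSymmDensity f m) : MemLp (fun t : ℝ => t) 2 (lineMeasure f) := by
  rw [memLp_two_iff_integrable_sq (by fun_prop), lineMeasure,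
    integrable_withDensity_iff hf.measurable.ennreal_ofReal (by simp)]
  refine hf.integrable_sq.congr (ae_of_all _ fun t => ?_)
  simp only
  rw [ENNReal.toReal_ofReal (hf.nonneg t)]

theorem measurePreserving_neg (hf : IsSymmDensity f m) :
    MeasurePreserving (fun t : ℝ => -t) (lineMeasure f) (lineMeasure f) := by
  refine ⟨measurable_neg, Measure.ext fun s hs => ?_⟩
  rw [Measure.map_apply measurable_neg hs, lineMeasure, withDensity_apply _ hs,
    withDensity_apply _ (measurable_neg hs), ← lintegral_indicator hs,
    ← lintegral_indicator (measurable_neg hs)]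
  have h := lintegral_neg_eq_self (μ := volume) (s.indicator fun t => ENNReal.ofReal (f t))
  rw [← h]
  refine lintegral_congr fun t => ?_
  by_cases ht : -t ∈ s
  · rw [Set.indicator_of_mem ht, Set.indicator_of_mem (show t ∈ (fun t => -t) ⁻¹' s from ht), hf.even]
  · rw [Set.indicator_of_notMem ht, Set.indicator_of_notMem (show t ∉ (fun t => -t) ⁻¹' s from ht)]

theorem integral_id (hf : IsSymmDensity f m) : ∫ t, t ∂(lineMeasure f) = 0 := by
  have h := hf.measurePreserving_neg.integral_comp (MeasurableEquiv.neg ℝ).measurableEmbedding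
    (fun t => t)
  rw [integral_neg] at h
  linarith

theorem variance_le (hf : IsSymmDensity f m) : Var[fun t => t; lineMeasure f] ≤ m := by
  rw [variance_of_integral_eq_zero (by fun_prop) hf.integral_id, hf.integral_lineMeasure]
  exact hf.integral_sq_le

end IsSymmDensity

theorem pi_lineMeasure {ι : Type*} [Fintype ι] {f : ι → ℝ → ℝ} {m : ι → ℝ}
    (hf : ∀ i, IsSymmDensity (f i) (m i)) :
    Measure.pi (fun i => lineMeasure (f i)) =
      (volume : Measure (ι → ℝ)).withDensity fun δ => ENNReal.ofReal (∏ i, f i (δ i)) := by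
  have := fun i => (hf i).isProbabilityMeasure
  refine (Measure.pi_eq fun s hs => ?_)
  rw [withDensity_apply _ (MeasurableSet.univ_pi hs), volume_pi, Measure.restrict_pi_pi,
    ← ofReal_integral_eq_lintegral_ofReal, integral_fintype_prod_eq_prod,
    ENNReal.ofReal_prod_of_nonneg]
  · refine Finset.prod_congr rfl fun i _ => ?_
    rw [lineMeasure, withDensity_apply _ (hs i), ofReal_integral_eq_lintegral_ofReal
      (hf i).integrable.integrableOn (ae_of_all _ (hf i).nonneg)]
  · exact fun i _ => integral_nonneg (hf i).nonneg
  · exact Integrable.fintype_prod fun i => (hf i).integrable.integrableOn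
  · exact ae_of_all _ fun δ => Finset.prod_nonneg fun i _ => (hf i).nonneg _

/-- The coordinates are independent and centred, so the second moment of the sum is its variance,
which is additive. -/
theorem lintegral_sq_sum_le {ι : Type*} [Fintype ι] {f : ι → ℝ → ℝ} {m : ι → ℝ}
    (hf : ∀ i, IsSymmDensity (f i) (m i)) (x : ι → ℝ) :
    ∫⁻ δ, ENNReal.ofReal ((∑ i, x i * δ i) ^ 2) ∂(Measure.pi fun i => lineMeasure (f i)) ≤
      ENNReal.ofReal (∑ i, x i ^ 2 * m i) := by
  have := fun i => (hf i).isProbabilityMeasure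
  have hmem : ∀ i, MemLp (fun t : ℝ => x i * t) 2 (lineMeasure (f i)) := fun i =>
    (hf i).memLp.const_mul (x i)
  have hev : ∀ i, MemLp (fun δ : ι → ℝ => x i * δ i) 2 (Measure.pi fun i => lineMeasure (f i)) :=
    fun i => (hmem i).comp_measurePreserving (measurePreserving_eval _ i)
  have hsum : MemLp (∑ i, fun δ : ι → ℝ => x i * δ i) 2 (Measure.pi fun i => lineMeasure (f i)) :=
    memLp_finsetSum' _ fun i _ => hev i
  have hV := variance_sum_pi hmem
  have hzero : ∫ δ, (∑ i, fun δ : ι → ℝ => x i * δ i) δ ∂(Measure.pi fun i => lineMeasure (f i)) = 0 := by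
    simp only [Finset.sum_apply]
    rw [integral_finsetSum _ fun i _ => (hev i).integrable one_le_two]
    refine Finset.sum_eq_zero fun i _ => ?_
    rw [integral_const_mul, integral_comp_eval (μ := fun i => lineMeasure (f i)) (f := fun t : ℝ => t)
      (by fun_prop), (hf i).integral_id, mul_zero]
  rw [variance_of_integral_eq_zero hsum.aestronglyMeasurable.aemeasurable hzero] at hV
  have hint := hsum.integrable_sq
  simp only [Finset.sum_apply] at hV hint
  rw [← ofReal_integral_eq_lintegral_ofReal hint (ae_of_all _ fun _ => sq_nonneg _), hV]
  refine ENNReal.ofReal_le_ofReal (Finset.sum_le_sum fun i _ => ?_)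
  rw [variance_const_mul]
  have := (hf i).variance_le
  gcongr

/-- The mean of ∑ δᵢ² is at most the number of coordinates times τ²; Markov's inequality at twice
that level leaves half the mass. -/
theorem half_le_pi_lineMeasure {ι : Type*} [Fintype ι] [Nonempty ι] {f : ι → ℝ → ℝ} {m : ι → ℝ} {τ : ℝ}
    (hτ : 0 < τ) (hf : ∀ i, IsSymmDensity (f i) (m i)) (hm : ∀ i, m i ≤ τ ^ 2) :
    2⁻¹ ≤ (Measure.pi fun i => lineMeasure (f i))
      {δ | ∑ i, δ i ^ 2 ≤ 2 * Fintype.card ι * τ ^ 2} := by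
  have := fun i => (hf i).isProbabilityMeasure
  set P := Measure.pi fun i => lineMeasure (f i)
  have hd : (0 : ℝ) < Fintype.card ι := by exact_mod_cast Fintype.card_pos
  have hE : MeasurableSet {δ : ι → ℝ | ∑ i, δ i ^ 2 ≤ 2 * Fintype.card ι * τ ^ 2} :=
    measurableSet_le (by fun_prop) measurable_const
  have hmean : ∫⁻ δ, ENNReal.ofReal (∑ i, δ i ^ 2) ∂P ≤ ENNReal.ofReal (Fintype.card ι * τ ^ 2) := by
    calc _ = ∑ i, ∫⁻ δ, ENNReal.ofReal (δ i ^ 2) ∂P := by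
          rw [← lintegral_finsetSum _ fun i _ => by fun_prop]
          refine lintegral_congr fun δ => ?_
          rw [ENNReal.ofReal_sum_of_nonneg fun i _ => sq_nonneg _]
      _ ≤ ∑ _i : ι, ENNReal.ofReal (τ ^ 2) := by
          refine Finset.sum_le_sum fun i _ => ?_
          classical
          -- The weight vector eᵢ isolates the second moment of one coordinate.
          have h := lintegral_sq_sum_le hf (Pi.single i 1)
          simp only [Pi.single_apply, ite_mul, one_mul, zero_mul, Finset.sum_ite_eq', Finset.mem_univ,
            if_true, ite_pow, one_pow, ne_eq, OfNat.ofNat_ne_zero, not_false_eq_true, zero_pow] at h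
          exact h.trans (ENNReal.ofReal_le_ofReal (hm i))
      _ = _ := by
          rw [Finset.sum_const, Finset.card_univ, nsmul_eq_mul, ENNReal.ofReal_mul (by positivity),
            ENNReal.ofReal_natCast]
  have hcompl : P {δ | ∑ i, δ i ^ 2 ≤ 2 * Fintype.card ι * τ ^ 2}ᶜ ≤ 2⁻¹ := by
    have hc : 0 < 2 * Fintype.card ι * τ ^ 2 := by positivity
    calc _ ≤ P {δ | ENNReal.ofReal (2 * Fintype.card ι * τ ^ 2) ≤ ENNReal.ofReal (∑ i, δ i ^ 2)} := by
          refine measure_mono fun δ hδ => ?_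
          have hδ' : ¬ ∑ i, δ i ^ 2 ≤ 2 * Fintype.card ι * τ ^ 2 := hδ
          exact ENNReal.ofReal_le_ofReal (not_le.1 hδ').le
      _ ≤ (∫⁻ δ, ENNReal.ofReal (∑ i, δ i ^ 2) ∂P) / ENNReal.ofReal (2 * Fintype.card ι * τ ^ 2) :=
          meas_ge_le_lintegral_div (Measurable.aemeasurable (by fun_prop))
            (ENNReal.ofReal_pos.2 hc).ne' ENNReal.ofReal_ne_top
      _ ≤ ENNReal.ofReal (Fintype.card ι * τ ^ 2) / ENNReal.ofReal (2 * Fintype.card ι * τ ^ 2) := by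
          gcongr
      _ = ENNReal.ofReal (2⁻¹) := by
          rw [← ENNReal.ofReal_div_of_pos hc]
          congr 1
          field_simp
      _ = _ := by rw [ENNReal.ofReal_inv_of_pos two_pos, ENNReal.ofReal_ofNat]
  have h1 := prob_add_prob_compl (μ := P) hE
  rw [← ENNReal.one_sub_inv_two, ← h1]
  refine tsub_le_iff_right.2 ?_
  gcongr

/-! ### Localising the prior on the coefficients -/

/-- The coordinate densities of the localised prior: uniform on `[-hτ, hτ]` for the coordinates in
`I`, scaled Student for the others. -/
noncomputable def localDensity {ι : Type*} [DecidableEq ι] (I : Finset ι) (h τ : ℝ) (i : ι) : ℝ → ℝ :=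
  if i ∈ I then Set.indicator (Set.Icc (-(h * τ)) (h * τ)) fun _ => (2 * (h * τ))⁻¹
  else fun t => (Real.pi / (2 * τ ^ 3))⁻¹ * ((τ ^ 2 + t ^ 2) ^ 2)⁻¹

theorem isSymmDensity_localDensity {ι : Type*} [DecidableEq ι] (I : Finset ι) {h τ : ℝ} (hh : 0 < h)
    (hτ : 0 < τ) (i : ι) :
    IsSymmDensity (localDensity I h τ i) (if i ∈ I then (h * τ) ^ 2 else τ ^ 2) := by
  unfold localDensity
  split_ifs
  · exact isSymmDensity_uniform (by positivity)
  · exact isSymmDensity_student hτ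

/-- On the uniform window |t| ≤ τ, so τ² + (u+t)² ≤ τ²(2 + |u|/τ)². The width 2hτ cancels the factor
h and leaves π/4 ≤ 1. Off `I` there is no shift and equality holds. -/
theorem localDensity_mul_le {ι : Type*} [DecidableEq ι] (I : Finset ι) {h τ : ℝ} (hh : 0 < h) (h1 : h ≤ 1)
    (hτ : 0 < τ) (i : ι) (u t : ℝ) (hu : i ∉ I → u = 0) :
    (Real.pi / (2 * τ ^ 3)) * (if i ∈ I then h * ((2 + |u| / τ) ^ 4)⁻¹ else 1) * localDensity I h τ i t ≤
      ((τ ^ 2 + (u + t) ^ 2) ^ 2)⁻¹ := by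
  unfold localDensity
  have hpi := Real.pi_pos
  split_ifs with hi
  · by_cases ht : t ∈ Set.Icc (-(h * τ)) (h * τ)
    · rw [Set.indicator_of_mem ht]
      have h2 : |t| ≤ τ := (abs_le.2 ht).trans (by nlinarith)
      have h3 : |u + t| ≤ (|u| / τ + 1) * τ := by
        refine (abs_add_le u t).trans ?_
        rw [add_mul, div_mul_cancel₀ _ hτ.ne']
        linarith
      have h4 : τ ^ 2 + (u + t) ^ 2 ≤ τ ^ 2 * (2 + |u| / τ) ^ 2 := by
        rw [← sq_abs (u + t)]
        have hv : 0 ≤ |u| / τ := by positivity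
        have := pow_le_pow_left₀ (abs_nonneg _) h3 2
        rw [mul_pow] at this
        nlinarith [mul_nonneg (sq_nonneg τ) hv]
      have h5 : (τ ^ 2 + (u + t) ^ 2) ^ 2 ≤ τ ^ 4 * (2 + |u| / τ) ^ 4 := by
        have := pow_le_pow_left₀ (by positivity) h4 2
        calc _ ≤ _ := this
          _ = _ := by ring
      have h6 : (τ ^ 4 * (2 + |u| / τ) ^ 4)⁻¹ ≤ ((τ ^ 2 + (u + t) ^ 2) ^ 2)⁻¹ := by gcongr
      refine le_trans ?_ h6
      have e : Real.pi / (2 * τ ^ 3) * (h * ((2 + |u| / τ) ^ 4)⁻¹) * (2 * (h * τ))⁻¹ =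
          Real.pi / 4 * (τ ^ 4 * (2 + |u| / τ) ^ 4)⁻¹ := by
        rw [mul_inv (τ ^ 4)]
        field_simp
        norm_num
      rw [e]
      refine mul_le_of_le_one_left (by positivity) ?_
      linarith [Real.pi_le_four]
    · rw [Set.indicator_of_notMem ht, mul_zero]
      positivity
  · rw [hu hi, zero_add, mul_one, mul_inv_cancel_left₀ (by positivity)]

theorem lintegral_vec {d : ℕ} (g : Vec d → ℝ≥0∞) :
    ∫⁻ θ, g θ = ∫⁻ δ : Fin d → ℝ, g (WithLp.toLp 2 δ) :=
  ((EuclideanSpace.volume_preserving_symm_measurableEquiv_toLp (Fin d)).symm.lintegral_comp_emb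
    (MeasurableEquiv.measurableEmbedding _) g).symm

theorem measurableSet_l1ball (d : ℕ) (C : ℝ) : MeasurableSet {θ : Vec d | l1norm θ ≤ C} := by
  refine measurableSet_le ?_ measurable_const
  unfold l1norm
  fun_prop

theorem lintegral_thetaPrior {d : ℕ} (τ C₁ : ℝ) {φ : Vec d → ℝ≥0∞} (hφ : Measurable φ) :
    ∫⁻ θ, φ θ ∂(thetaPrior d τ C₁) =
      (∫⁻ θ in {θ : Vec d | l1norm θ ≤ C₁}, ENNReal.ofReal (∏ i, ((τ ^ 2 + θ i ^ 2) ^ 2)⁻¹))⁻¹ *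
      ∫⁻ θ in {θ : Vec d | l1norm θ ≤ C₁}, ENNReal.ofReal (∏ i, ((τ ^ 2 + θ i ^ 2) ^ 2)⁻¹) * φ θ := by
  have hmd : Measurable fun θ : Vec d => ENNReal.ofReal (∏ i, ((τ ^ 2 + θ i ^ 2) ^ 2)⁻¹) := by
    fun_prop
  unfold thetaPrior normalize
  rw [lintegral_smul_measure, withDensity_apply _ MeasurableSet.univ, Measure.restrict_univ,
    lintegral_withDensity_eq_lintegral_mul _ hmd hφ, smul_eq_mul]
  rfl

theorem lintegral_student_pi_le {d : ℕ} {τ : ℝ} (hτ : 0 < τ) (C₁ : ℝ) :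
    ∫⁻ θ in {θ : Vec d | l1norm θ ≤ C₁}, ENNReal.ofReal (∏ i, ((τ ^ 2 + θ i ^ 2) ^ 2)⁻¹) ≤
      ENNReal.ofReal ((Real.pi / (2 * τ ^ 3)) ^ d) := by
  refine (setLIntegral_le_lintegral _ _).trans ?_
  rw [lintegral_vec]
  change ∫⁻ δ : Fin d → ℝ, ENNReal.ofReal (∏ i, ((τ ^ 2 + δ i ^ 2) ^ 2)⁻¹) ≤ _
  rw [volume_pi, ← ofReal_integral_eq_lintegral_ofReal
    (Integrable.fintype_prod fun _ => integrable_student hτ)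
    (ae_of_all _ fun δ => Finset.prod_nonneg fun i _ => by positivity)]
  rw [integral_fintype_prod_eq_prod (fun (_ : Fin d) (t : ℝ) => ((τ ^ 2 + t ^ 2) ^ 2)⁻¹)]
  simp [integral_student hτ, div_pow]

/-- By Cauchy-Schwarz, ∑ |δᵢ| ≤ √2 dτ ≤ 2dτ, which is the margin assumed between θ₀ and the boundary
of the ℓ₁-ball. -/
theorem l1norm_add_le {d : ℕ} (θ : Vec d) {τ C₁ : ℝ} (hτ : 0 < τ) (hl1 : l1norm θ ≤ C₁ - 2 * d * τ)
    (δ : Fin d → ℝ) (hδ : ∑ i, δ i ^ 2 ≤ 2 * d * τ ^ 2) : l1norm (θ + WithLp.toLp 2 δ) ≤ C₁ := by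
  have h1 : ∑ i, |δ i| ≤ 2 * d * τ := by
    refine abs_le_of_sq_le_sq' ?_ (by positivity) |>.2
    have := sq_sum_le_card_mul_sum_sq (s := Finset.univ) (f := fun i => |δ i|)
    simp only [sq_abs, Finset.card_univ, Fintype.card_fin] at this
    nlinarith [mul_le_mul_of_nonneg_left hδ (Nat.cast_nonneg (α := ℝ) d), sq_nonneg (d * τ)]
  have h2 : l1norm (θ + WithLp.toLp 2 δ) ≤ l1norm θ + ∑ i, |δ i| := by
    unfold l1norm
    rw [← Finset.sum_add_distrib]
    exact Finset.sum_le_sum fun i _ => abs_add_le _ _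
  linarith

/-- The scaled Student prior dominates a multiple of a probability measure that is symmetric about
`θ₀` and concentrated around it. -/
theorem exists_local_prior {d : ℕ} (hd : 0 < d) (θ₀ : Vec d) {τ C₁ h M : ℝ} (hτ : 0 < τ)
    (hl1 : l1norm θ₀ ≤ C₁ - 2 * d * τ) (hh : 0 < h) (h1 : h ≤ 1) (I : Finset (Fin d))
    (hI : ∀ i, i ∉ I → θ₀ i = 0) (hM : ∀ i, (if i ∈ I then (h * τ) ^ 2 else τ ^ 2) ≤ M) :
    ∃ ρ : Measure (Vec d), IsProbabilityMeasure ρ ∧ MeasurePreserving (fun δ => -δ) ρ ρ ∧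
      (∀ x : Vec d, ∫⁻ δ, ENNReal.ofReal (inner ℝ x δ ^ 2) ∂ρ ≤ ENNReal.ofReal (2 * M * ‖x‖ ^ 2)) ∧
      ∀ φ : Vec d → ℝ≥0∞, Measurable φ →
        ENNReal.ofReal (2⁻¹ * ∏ i ∈ I, (h * ((2 + |θ₀ i| / τ) ^ 4)⁻¹)) * ∫⁻ δ, φ (θ₀ + δ) ∂ρ ≤
          ∫⁻ θ, φ θ ∂(thetaPrior d τ C₁) := by
  have hpi := Real.pi_pos
  have : Nonempty (Fin d) := ⟨⟨0, hd⟩⟩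
  have hf := isSymmDensity_localDensity I hh hτ
  have := fun i => (hf i).isProbabilityMeasure
  set P := Measure.pi fun i => lineMeasure (localDensity I h τ i) with hP
  -- Conditioning on `E` keeps θ₀ + δ inside the support of the prior. Since `E` is invariant under
  -- δ ↦ -δ the symmetry survives, and since its mass is at least 1/2 second moments at most double.
  set E : Set (Fin d → ℝ) := {δ | ∑ i, δ i ^ 2 ≤ 2 * d * τ ^ 2} with hE
  have hEm : MeasurableSet E := measurableSet_le (by fun_prop) measurable_const
  have hPE : 2⁻¹ ≤ P E := by
    have := half_le_pi_lineMeasure hτ hf (fun i => by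
      split_ifs
      · rw [mul_pow]
        exact mul_le_of_le_one_left (sq_nonneg τ) (pow_le_one₀ hh.le h1)
      · exact le_rfl)
    simpa only [Fintype.card_fin] using this
  have hPE0 : P E ≠ 0 := fun h0 => by simp [h0] at hPE
  have hPEinv : (P E)⁻¹ ≤ 2 := by
    rw [← inv_inv (2 : ℝ≥0∞)]
    exact ENNReal.inv_le_inv.2 hPE
  have hcondprob := cond_isProbabilityMeasure hPE0
  have hcond : ∀ g : (Fin d → ℝ) → ℝ≥0∞, ∫⁻ δ, g δ ∂P[|E] ≤ 2 * ∫⁻ δ in E, g δ ∂P := by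
    intro g
    rw [ProbabilityTheory.cond, lintegral_smul_measure, smul_eq_mul]
    gcongr
  have hlp : Measurable (WithLp.toLp 2 : (Fin d → ℝ) → Vec d) := by fun_prop
  refine ⟨P[|E].map (WithLp.toLp 2), Measure.isProbabilityMeasure_map hlp.aemeasurable,
    ⟨measurable_neg, ?_⟩, ?_, ?_⟩
  · have hneg : MeasurePreserving (fun δ : Fin d → ℝ => -δ) P P :=
      measurePreserving_pi _ _ fun i => (hf i).measurePreserving_neg
    have hpre : (fun δ : Fin d → ℝ => -δ) ⁻¹' E = E := by
      ext δ
      simp [hE]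
    have hnc : P[|E].map (fun δ : Fin d → ℝ => -δ) = P[|E] := by
      rw [ProbabilityTheory.cond, Measure.map_smul]
      congr 1
      have := (hneg.restrict_preimage hEm).map_eq
      rwa [hpre] at this
    rw [Measure.map_map measurable_neg hlp]
    have e : (fun δ : Vec d => -δ) ∘ (WithLp.toLp 2 : (Fin d → ℝ) → Vec d) =
        (WithLp.toLp 2 : (Fin d → ℝ) → Vec d) ∘ fun δ => -δ := rfl
    rw [e, ← Measure.map_map hlp measurable_neg, hnc]
  · intro x
    rw [lintegral_map (by fun_prop) hlp]
    refine (hcond _).trans ?_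
    have e : ∀ δ : Fin d → ℝ, inner ℝ x (WithLp.toLp 2 δ) = ∑ i, x i * δ i := fun δ => by
      simp [PiLp.inner_apply, mul_comm]
    simp_rw [e]
    calc _ ≤ 2 * ENNReal.ofReal (∑ i, x i ^ 2 * (if i ∈ I then (h * τ) ^ 2 else τ ^ 2)) := by
          gcongr
          exact (setLIntegral_le_lintegral _ _).trans (lintegral_sq_sum_le hf x)
      _ ≤ 2 * ENNReal.ofReal (M * ‖x‖ ^ 2) := by
          gcongr
          rw [EuclideanSpace.real_norm_sq_eq, Finset.mul_sum]
          refine Finset.sum_le_sum fun i _ => ?_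
          rw [mul_comm]
          have := hM i
          gcongr
      _ = _ := by
          rw [mul_assoc 2 M, ENNReal.ofReal_mul zero_le_two, ENNReal.ofReal_ofNat]
  · intro φ hφ
    rw [lintegral_map (by fun_prop) hlp, lintegral_thetaPrior _ _ hφ]
    set J := Real.pi / (2 * τ ^ 3) with hJ
    have hJpos : 0 < J := by positivity
    set κ := ∏ i ∈ I, (h * ((2 + |θ₀ i| / τ) ^ 4)⁻¹) with hκ
    have hκpos : 0 < κ := Finset.prod_pos fun i _ => by positivity
    have hfnn : ∀ δ : Fin d → ℝ, 0 ≤ ∏ i, localDensity I h τ i (δ i) := fun δ =>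
      Finset.prod_nonneg fun i _ => (hf i).nonneg _
    have hmf : Measurable fun δ : Fin d → ℝ => ENNReal.ofReal (∏ i, localDensity I h τ i (δ i)) :=
      (Finset.measurable_prod _ fun i _ =>
        (hf i).measurable.comp (measurable_pi_apply i)).ennreal_ofReal
    have hpt : ∀ δ : Fin d → ℝ, J ^ d * κ * ∏ i, localDensity I h τ i (δ i) ≤
        ∏ i, ((τ ^ 2 + (θ₀ + WithLp.toLp 2 δ) i ^ 2) ^ 2)⁻¹ := by
      intro δ
      have e : J ^ d * κ * ∏ i, localDensity I h τ i (δ i) =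
          ∏ i, (J * (if i ∈ I then h * ((2 + |θ₀ i| / τ) ^ 4)⁻¹ else 1) * localDensity I h τ i (δ i)) := by
        rw [Finset.prod_mul_distrib, Finset.prod_mul_distrib, Finset.prod_ite_mem, Finset.univ_inter]
        simp [hκ]
      rw [e]
      refine Finset.prod_le_prod (fun i _ => ?_) fun i _ =>
        localDensity_mul_le I hh h1 hτ i (θ₀ i) (δ i) (hI i)
      have := (hf i).nonneg (δ i)
      split_ifs <;> positivity
    -- Translation by θ₀ preserves Lebesgue measure, so the pointwise comparison of densities can be
    -- integrated over `E`.
    have hnum : ENNReal.ofReal (J ^ d * κ) * ∫⁻ δ in E, φ (θ₀ + WithLp.toLp 2 δ) ∂P ≤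
        ∫⁻ θ in {θ : Vec d | l1norm θ ≤ C₁},
          ENNReal.ofReal (∏ i, ((τ ^ 2 + θ i ^ 2) ^ 2)⁻¹) * φ θ := by
      rw [← lintegral_indicator (measurableSet_l1ball d C₁), ← lintegral_add_left_eq_self _ θ₀,
        lintegral_vec, hP, pi_lineMeasure hf, setLIntegral_withDensity_eq_setLIntegral_mul _ hmf
        (by fun_prop) hEm, ← lintegral_const_mul _ (by fun_prop), ← lintegral_indicator hEm]
      refine lintegral_mono fun δ => ?_
      by_cases hδ : δ ∈ E
      · rw [Set.indicator_of_mem hδ, Set.indicator_of_mem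
          (show θ₀ + WithLp.toLp 2 δ ∈ {θ : Vec d | l1norm θ ≤ C₁} from l1norm_add_le θ₀ hτ hl1 δ hδ)]
        simp only [Pi.mul_apply]
        rw [← mul_assoc, ← ENNReal.ofReal_mul (by positivity)]
        gcongr
        exact hpt δ
      · rw [Set.indicator_of_notMem hδ]
        exact zero_le
    -- The 2⁻¹ pays for the conditioning. The factor J^d cancels against the normalising constant of
    -- the prior, which is at most J^d because truncation to the ball only decreases it.
    calc _ ≤ ENNReal.ofReal (2⁻¹ * κ) * (2 * ∫⁻ δ in E, φ (θ₀ + WithLp.toLp 2 δ) ∂P) := by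
          gcongr
          exact hcond _
      _ = (ENNReal.ofReal (J ^ d))⁻¹ *
            (ENNReal.ofReal (J ^ d * κ) * ∫⁻ δ in E, φ (θ₀ + WithLp.toLp 2 δ) ∂P) := by
          have e1 : ENNReal.ofReal κ = ENNReal.ofReal (2⁻¹ * κ) * 2 := by
            rw [← ENNReal.ofReal_ofNat 2, ← ENNReal.ofReal_mul (by positivity)]
            congr 1
            ring
          rw [ENNReal.ofReal_mul (by positivity : 0 ≤ J ^ d), e1, mul_assoc (ENNReal.ofReal (J ^ d)),
            ENNReal.inv_mul_cancel_left (ENNReal.ofReal_pos.2 (by positivity)).ne' ENNReal.ofReal_ne_top,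
            mul_assoc]
      _ ≤ _ := by
          gcongr
          exact lintegral_student_pi_le hτ C₁

/-! ### Prior mass of the noise scale -/

/-- The scale parameters whose precision `σ⁻²` lies in `[g, g (1 + 1 / n)]`. -/
def precisionWindow (g : ℝ) (n : ℕ) : Set ℝ :=
  {σ | 0 < σ ∧ g ≤ (σ ^ 2)⁻¹ ∧ (σ ^ 2)⁻¹ ≤ g * (1 + 1 / n)}

theorem measurableSet_precisionWindow (g : ℝ) (n : ℕ) : MeasurableSet (precisionWindow g n) :=
  have h : Measurable fun σ : ℝ => (σ ^ 2)⁻¹ := by fun_prop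
  measurableSet_Ioi.inter ((measurableSet_le measurable_const h).inter
    (measurableSet_le h measurable_const))

/-- The precision has a Gamma law of rate b = n^{-1/2}. Its density on the window is at least a
constant times b^a = n^{-a/2}, and the window has length g/n, whence the order n^{-(1+a/2)}. -/
theorem le_sigmaPrior_precisionWindow {a lo hi g : ℝ} {n : ℕ} (ha : 0 < a) (hlo : 0 < lo) (hg : lo ≤ g)
    (hg' : g ≤ hi) (hn : 1 ≤ n) :
    ENNReal.ofReal (lo * ((Real.Gamma a)⁻¹ * (lo ^ a / (2 * hi)) * Real.exp (-(2 * hi))) *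
      Real.exp (-((1 + a / 2) * Real.log n))) ≤
      sigmaPrior a (1 / Real.sqrt n) (precisionWindow g n) := by
  have hn0 : (1 : ℝ) ≤ n := by exact_mod_cast hn
  have hnpos : (0 : ℝ) < n := by linarith
  have hg0 : 0 < g := hlo.trans_le hg
  have hhi : 0 < hi := hg0.trans_le hg'
  set b : ℝ := 1 / Real.sqrt n with hb
  have hsqrt : 1 ≤ Real.sqrt n := Real.one_le_sqrt.2 hn0
  have hbpos : 0 < b := by positivity
  have hb1 : b ≤ 1 := (div_le_one (by positivity)).2 hsqrt
  have hG := Real.Gamma_pos_of_pos ha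
  have hn1 : 1 / (n : ℝ) ≤ 1 := (div_le_one hnpos).2 hn0
  have hsub : Set.Icc g (g * (1 + 1 / n)) ⊆ (fun x => Real.sqrt x⁻¹) ⁻¹' precisionWindow g n := by
    intro x hx
    have hx0 : 0 < x := hg0.trans_le hx.1
    refine ⟨by positivity, ?_⟩
    rw [Real.sq_sqrt (by positivity), inv_inv]
    exact hx
  have hba : b ^ a = Real.exp (-((a / 2) * Real.log n)) := by
    rw [Real.rpow_def_of_pos hbpos, hb, Real.log_div one_ne_zero (by positivity), Real.log_one,
      Real.log_sqrt hnpos.le]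
    congr 1
    ring
  have hninv : 1 / (n : ℝ) = Real.exp (-Real.log n) := by
    rw [Real.exp_neg, Real.exp_log hnpos, one_div]
  set D : ℝ := b ^ a / Real.Gamma a * (lo ^ a / (2 * hi)) * Real.exp (-(2 * hi)) with hD
  have hDpos : 0 < D := by positivity
  have hdens : ∀ x ∈ Set.Icc g (g * (1 + 1 / n)), ENNReal.ofReal D ≤ gammaPDF a b x := by
    intro x hx
    have hx0 : 0 < x := hg0.trans_le hx.1
    have hx2 : x ≤ 2 * hi := hx.2.trans (by nlinarith)
    rw [gammaPDF_of_nonneg hx0.le]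
    apply ENNReal.ofReal_le_ofReal
    -- Writing x^{a-1} as x^a / x allows the two factors to be bounded separately, whatever the sign
    -- of a - 1.
    rw [Real.rpow_sub_one hx0.ne']
    have h1 : lo ^ a ≤ x ^ a := Real.rpow_le_rpow hlo.le (hg.trans hx.1) ha.le
    have h2 : b * x ≤ 2 * hi := by nlinarith
    rw [hD]
    gcongr
  unfold sigmaPrior
  rw [Measure.map_apply (by fun_prop) (measurableSet_precisionWindow g n)]
  refine le_trans ?_ (measure_mono hsub)
  rw [gammaMeasure, withDensity_apply _ measurableSet_Icc]
  refine le_trans ?_ (setLIntegral_mono' measurableSet_Icc hdens)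
  rw [setLIntegral_const, Real.volume_Icc, ← ENNReal.ofReal_mul hDpos.le]
  apply ENNReal.ofReal_le_ofReal
  have e : g * (1 + 1 / n) - g = g * (1 / n) := by ring
  have e2 : Real.exp (-((1 + a / 2) * Real.log n)) =
      Real.exp (-((a / 2) * Real.log n)) * Real.exp (-Real.log n) := by
    rw [← Real.exp_add]
    ring_nf
  rw [e, hninv, e2, hD, hba]
  calc _ = Real.exp (-(a / 2 * Real.log n)) / Real.Gamma a * (lo ^ a / (2 * hi)) * Real.exp (-(2 * hi)) *
        (lo * Real.exp (-Real.log n)) := by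
        rw [div_eq_mul_inv]
        ring
    _ ≤ _ := by gcongr

/-! ### Exponential moments and Jensen's inequality -/

theorem lintegral_pi_prod {Z : Type*} [MeasurableSpace Z] (P : Measure Z) [IsProbabilityMeasure P]
    {n : ℕ} {g : Z → ℝ≥0∞} (hg : Measurable g) :
    ∫⁻ z, ∏ i, g (z i) ∂(Measure.pi fun _ : Fin n => P) = (∫⁻ w, g w ∂P) ^ n := by
  rw [lintegral_prod_eq_prod_lintegral_of_indepFun Finset.univ (fun i (z : Fin n → Z) => g (z i))
    (iIndepFun_pi fun _ => hg.aemeasurable) fun i => hg.comp (measurable_pi_apply i)]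
  have (i : Fin n) : ∫⁻ z, g (z i) ∂(Measure.pi fun _ : Fin n => P) = ∫⁻ w, g w ∂P :=
    (measurePreserving_eval (fun _ : Fin n => P) i).lintegral_comp hg
  simp [this]

/-- The exponential moment inequality behind PAC-Bayes bounds: normalising a product of i.i.d.
nonnegative factors by its mean and integrating against a fixed prior has expectation at most one. -/
theorem lintegral_normalized_prod_le_one {Z T : Type*} [MeasurableSpace Z] [MeasurableSpace T]
    (P : Measure Z) [IsProbabilityMeasure P] (π : Measure T) [IsProbabilityMeasure π] (n : ℕ)
    {r : T × Z → ℝ≥0∞} (hr : Measurable r) :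
    ∫⁻ z, ∫⁻ t, (∏ i, r (t, z i)) * (∫⁻ w, r (t, w) ∂P)⁻¹ ^ n ∂π ∂(Measure.pi fun _ : Fin n => P) ≤ 1 := by
  have hH : Measurable fun t => ∫⁻ w, r (t, w) ∂P := hr.lintegral_prod_right'
  have hri : ∀ i : Fin n, Measurable fun q : (Fin n → Z) × T => r (q.2, q.1 i) := fun i =>
    hr.comp (by fun_prop)
  have hprod : Measurable fun q : (Fin n → Z) × T => ∏ i, r (q.2, q.1 i) :=
    Finset.measurable_prod _ fun i _ => hri i
  rw [lintegral_lintegral_swap (Measurable.aemeasurable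
    (hprod.mul ((hH.inv.pow_const n).comp measurable_snd)))]
  have hle : ∀ t, ∫⁻ z, (∏ i, r (t, z i)) * (∫⁻ w, r (t, w) ∂P)⁻¹ ^ n
      ∂(Measure.pi fun _ : Fin n => P) ≤ 1 := by
    intro t
    have hrt : Measurable fun w => r (t, w) := hr.comp (by fun_prop)
    have hpt : Measurable fun z : Fin n → Z => ∏ i, r (t, z i) :=
      Finset.measurable_prod _ fun i _ => hrt.comp (measurable_pi_apply i)
    rw [lintegral_mul_const _ hpt,
      lintegral_pi_prod P hrt, ← mul_pow]
    -- An inequality only, so that a mean equal to 0 or ∞ needs no separate treatment.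
    exact pow_le_one₀ zero_le (ENNReal.mul_inv_le_one _)
  refine (lintegral_mono hle).trans ?_
  simp

/-- Jensen's inequality for the exponential function, against a normalised density. -/
theorem lintegral_normalize_le_of_exp_le {T : Type*} [MeasurableSpace T] (π : Measure T)
    {w : T → ℝ≥0∞} (hw : Measurable w) (h0 : ∫⁻ t, w t ∂π ≠ 0) (htop : ∫⁻ t, w t ∂π ≠ ∞)
    {f : T → ℝ} (hf : Measurable f) (hf0 : ∀ᵐ t ∂π, 0 ≤ f t) {m : ℝ} (hm : 0 ≤ m)
    (h : ∫⁻ t, w t * ENNReal.ofReal (Real.exp (f t)) ∂π ≤ ENNReal.ofReal (Real.exp m) * ∫⁻ t, w t ∂π) :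
    ∫⁻ t, ENNReal.ofReal (f t) ∂(normalize (π.withDensity w)) ≤ ENNReal.ofReal m := by
  have huniv : π.withDensity w Set.univ = ∫⁻ t, w t ∂π := by
    rw [withDensity_apply _ MeasurableSet.univ, Measure.restrict_univ]
  have hN : ∀ g : T → ℝ≥0∞, Measurable g → ∫⁻ t, g t ∂(normalize (π.withDensity w)) =
      (∫⁻ t, w t ∂π)⁻¹ * ∫⁻ t, w t * g t ∂π := by
    intro g hg
    rw [normalize, lintegral_smul_measure, huniv, lintegral_withDensity_eq_lintegral_mul _ hw hg,
      smul_eq_mul]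
    rfl
  have hprob : IsProbabilityMeasure (normalize (π.withDensity w)) :=
    isProbabilityMeasure_normalize (by rwa [huniv]) (by rwa [huniv])
  have hac : normalize (π.withDensity w) ≪ π :=
    (withDensity_absolutelyContinuous π w).smul_left _
  have hexp : ∫⁻ t, ENNReal.ofReal (Real.exp (f t)) ∂(normalize (π.withDensity w)) ≤
      ENNReal.ofReal (Real.exp m) := by
    rw [hN _ (by fun_prop)]
    calc _ ≤ (∫⁻ t, w t ∂π)⁻¹ * (ENNReal.ofReal (Real.exp m) * ∫⁻ t, w t ∂π) := by gcongr
      _ = _ := by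
          rw [mul_comm (ENNReal.ofReal _), ENNReal.inv_mul_cancel_left h0 htop]
  -- The tangent inequality f + 1 ≤ m + e^{f-m} is integrated with both sides nonnegative, so
  -- integrability of f is not needed.
  have key : ∫⁻ t, (ENNReal.ofReal (f t) + 1) ∂(normalize (π.withDensity w)) ≤
      ∫⁻ t, (ENNReal.ofReal m + ENNReal.ofReal (Real.exp (-m)) * ENNReal.ofReal (Real.exp (f t)))
        ∂(normalize (π.withDensity w)) := by
    refine lintegral_mono_ae ?_
    filter_upwards [hac.ae_le hf0] with t ht
    rw [← ENNReal.ofReal_mul (Real.exp_pos _).le, ← Real.exp_add,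
      ← ENNReal.ofReal_add hm (Real.exp_pos _).le, ← ENNReal.ofReal_one, ← ENNReal.ofReal_add ht zero_le_one]
    apply ENNReal.ofReal_le_ofReal
    linarith [Real.add_one_le_exp (-m + f t)]
  rw [lintegral_add_right _ measurable_const, lintegral_add_left measurable_const,
    lintegral_const, lintegral_const, measure_univ, mul_one, mul_one,
    lintegral_const_mul _ (by fun_prop)] at key
  have hone : ENNReal.ofReal (Real.exp (-m)) *
      ∫⁻ t, ENNReal.ofReal (Real.exp (f t)) ∂(normalize (π.withDensity w)) ≤ 1 := by
    calc _ ≤ ENNReal.ofReal (Real.exp (-m)) * ENNReal.ofReal (Real.exp m) := by gcongr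
      _ = 1 := by
          rw [← ENNReal.ofReal_mul (Real.exp_pos _).le, ← Real.exp_add, neg_add_cancel, Real.exp_zero,
            ENNReal.ofReal_one]
  have := key.trans (by gcongr : _ ≤ ENNReal.ofReal m + 1)
  exact (ENNReal.add_le_add_iff_right ENNReal.one_ne_top).1 this

/-! ### Affinity and Rényi divergence in the model -/

theorem modelDensity_pos {d : ℕ} (θ : Vec d) {σ : ℝ} (hσ : 0 < σ) (z : ℝ × Vec d) :
    0 < modelDensity θ σ z :=
  gaussianPDFReal_pos _ _ _ (by simpa using hσ.ne')

theorem isProbabilityMeasure_modelLaw {d : ℕ} (Q : Measure (Vec d)) [IsProbabilityMeasure Q]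
    (θ : Vec d) (σ : ℝ) : IsProbabilityMeasure (modelLaw Q θ σ) :=
  Measure.isProbabilityMeasure_map (by fun_prop)

theorem measurable_modelDensity {d : ℕ} (θ : Vec d) (σ : ℝ) : Measurable (modelDensity θ σ) := by
  unfold modelDensity gaussianPDFReal
  fun_prop

theorem measurable_modelDensity_uncurry {d : ℕ} :
    Measurable fun q : (Vec d × ℝ) × (ℝ × Vec d) => modelDensity q.1.1 q.1.2 q.2 := by
  unfold modelDensity gaussianPDFReal
  fun_prop

/-- The Hellinger-type affinity `∫ (p_{θ,σ} / p_{θ₀,σ₀})^α dP_{θ₀,σ₀}`. -/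
noncomputable def affinity {d : ℕ} (α : ℝ) (Q : Measure (Vec d)) (θ₀ : Vec d) (σ₀ : ℝ)
    (p : Vec d × ℝ) : ℝ≥0∞ :=
  ∫⁻ z, ENNReal.ofReal ((modelDensity p.1 p.2 z / modelDensity θ₀ σ₀ z) ^ α) ∂(modelLaw Q θ₀ σ₀)

theorem affinity_eq {d : ℕ} (α : ℝ) (Q : Measure (Vec d))
    [IsProbabilityMeasure Q] (θ θ₀ : Vec d) {σ σ₀ : ℝ} (hσ : 0 < σ) (hσ₀ : 0 < σ₀) :
    affinity α Q θ₀ σ₀ (θ, σ) = ∫⁻ z, ENNReal.ofReal (modelDensity θ σ z) ^ α *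
      ENNReal.ofReal (modelDensity θ₀ σ₀ z) ^ (1 - α) ∂(volume.prod Q) := by
  have hm := measurable_modelDensity θ σ
  have hm₀ := measurable_modelDensity θ₀ σ₀
  rw [affinity, modelLaw_eq_withDensity Q θ₀ hσ₀,
    lintegral_withDensity_eq_lintegral_mul _ hm₀.ennreal_ofReal (by fun_prop)]
  refine lintegral_congr fun z => ?_
  have hp := modelDensity_pos θ hσ z
  have hp₀ := modelDensity_pos θ₀ hσ₀ z
  simp only [Pi.mul_apply]
  rw [ENNReal.ofReal_rpow_of_pos hp, ENNReal.ofReal_rpow_of_pos hp₀, ← ENNReal.ofReal_mul hp₀.le,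
    ← ENNReal.ofReal_mul (by positivity), Real.div_rpow hp.le hp₀.le, Real.rpow_sub hp₀, Real.rpow_one]
  congr 1
  ring

theorem affinity_ne_zero {d : ℕ} (α : ℝ) (Q : Measure (Vec d)) [IsProbabilityMeasure Q] (θ θ₀ : Vec d)
    {σ σ₀ : ℝ} (hσ : 0 < σ) (hσ₀ : 0 < σ₀) : affinity α Q θ₀ σ₀ (θ, σ) ≠ 0 := by
  have hm := measurable_modelDensity θ σ
  have hm₀ := measurable_modelDensity θ₀ σ₀
  have := isProbabilityMeasure_modelLaw Q θ₀ σ₀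
  intro h
  rw [affinity, lintegral_eq_zero_iff (by fun_prop)] at h
  have : ∀ᵐ z ∂(modelLaw Q θ₀ σ₀), False := by
    filter_upwards [h] with z hz
    have hp := modelDensity_pos θ hσ z
    have hp₀ := modelDensity_pos θ₀ hσ₀ z
    exact (ENNReal.ofReal_pos.2 (by positivity)).ne' hz
  exact this.exists.choose_spec

/-- Hölder's inequality with exponents 1/α and 1/(1-α). It makes -log of the affinity nonnegative,
as Jensen's inequality under the posterior requires. -/
theorem affinity_le_one {d : ℕ} {α : ℝ} (h0 : 0 < α) (h1 : α < 1) (Q : Measure (Vec d))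
    [IsProbabilityMeasure Q] (θ θ₀ : Vec d) {σ σ₀ : ℝ} (hσ : 0 < σ) (hσ₀ : 0 < σ₀) :
    affinity α Q θ₀ σ₀ (θ, σ) ≤ 1 := by
  have hm := measurable_modelDensity θ σ
  have hm₀ := measurable_modelDensity θ₀ σ₀
  have hone : ∀ (θ : Vec d) {σ : ℝ}, 0 < σ →
      ∫⁻ z, ENNReal.ofReal (modelDensity θ σ z) ∂(volume.prod Q) = 1 := by
    intro θ σ hσ
    have := isProbabilityMeasure_modelLaw Q θ σ
    have h := measure_univ (μ := modelLaw Q θ σ)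
    rwa [modelLaw_eq_withDensity Q θ hσ, withDensity_apply _ MeasurableSet.univ,
      Measure.restrict_univ] at h
  rw [affinity_eq α Q θ θ₀ hσ hσ₀]
  refine (ENNReal.lintegral_mul_norm_pow_le hm.ennreal_ofReal.aemeasurable
    hm₀.ennreal_ofReal.aemeasurable h0.le (by linarith) (by ring)).trans ?_
  rw [hone θ hσ, hone θ₀ hσ₀, ENNReal.one_rpow, ENNReal.one_rpow, one_mul]

theorem renyiDiv_modelLaw {d : ℕ} {α : ℝ} (h0 : 0 < α) (h1 : α < 1) (Q : Measure (Vec d))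
    [IsProbabilityMeasure Q] (θ θ₀ : Vec d) {σ σ₀ : ℝ} (hσ : 0 < σ) (hσ₀ : 0 < σ₀) :
    (renyiDiv α (modelLaw Q θ σ) (modelLaw Q θ₀ σ₀)).toENNReal =
      ENNReal.ofReal ((1 - α)⁻¹ * -Real.log (affinity α Q θ₀ σ₀ (θ, σ)).toReal) := by
  have hm := measurable_modelDensity θ σ
  have hm₀ := measurable_modelDensity θ₀ σ₀
  have := isProbabilityMeasure_modelLaw Q θ σ
  have := isProbabilityMeasure_modelLaw Q θ₀ σ₀
  have hne := affinity_ne_zero α Q θ θ₀ hσ hσ₀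
  have htop : affinity α Q θ₀ σ₀ (θ, σ) ≠ ∞ :=
    ((affinity_le_one h0 h1 Q θ θ₀ hσ hσ₀).trans_lt ENNReal.one_lt_top).ne
  have e : renyiDiv α (modelLaw Q θ σ) (modelLaw Q θ₀ σ₀) =
      (((α - 1)⁻¹ : ℝ) : EReal) * ENNReal.log (affinity α Q θ₀ σ₀ (θ, σ)) := by
    have ew := modelLaw_eq_withDensity Q θ hσ
    have ew₀ := modelLaw_eq_withDensity Q θ₀ hσ₀
    rw [renyiDiv_eq h0 h1 _ _ (volume.prod Q) (by rw [ew]; exact withDensity_absolutelyContinuous _ _)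
      (by rw [ew₀]; exact withDensity_absolutelyContinuous _ _), affinity_eq α Q θ θ₀ hσ hσ₀]
    congr 2
    rw [ew, ew₀]
    refine lintegral_congr_ae ?_
    filter_upwards [Measure.rnDeriv_withDensity (volume.prod Q) hm.ennreal_ofReal,
      Measure.rnDeriv_withDensity (volume.prod Q) hm₀.ennreal_ofReal] with z h1 h2
    rw [h1, h2]
  rw [e, ENNReal.log_pos_real hne htop, ← EReal.coe_mul, EReal.real_coe_toENNReal]
  congr 1
  rw [← neg_sub 1 α, inv_neg]
  ring

theorem measurable_affinity {d : ℕ} (α : ℝ) (Q : Measure (Vec d)) [IsProbabilityMeasure Q] (θ₀ : Vec d)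
    (σ₀ : ℝ) : Measurable (affinity α Q θ₀ σ₀) := by
  have := isProbabilityMeasure_modelLaw Q θ₀ σ₀
  have hm := measurable_modelDensity_uncurry (d := d)
  have hm₀ := measurable_modelDensity θ₀ σ₀
  exact Measurable.lintegral_prod_right' (f := fun q : (Vec d × ℝ) × (ℝ × Vec d) =>
    ENNReal.ofReal ((modelDensity q.1.1 q.1.2 q.2 / modelDensity θ₀ σ₀ q.2) ^ α)) (by fun_prop)

/-! ### Lower bound on the evidence -/

theorem ofReal_integral_le_lintegral {T : Type*} [MeasurableSpace T] {ρ : Measure T} {u : T → ℝ}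
    (hu : Integrable u ρ) : ENNReal.ofReal (∫ t, u t ∂ρ) ≤ ∫⁻ t, ENNReal.ofReal (u t) ∂ρ := by
  rw [integral_eq_lintegral_pos_part_sub_lintegral_neg_part hu]
  refine (ENNReal.ofReal_le_ofReal (sub_le_self _ ENNReal.toReal_nonneg)).trans ?_
  exact ENNReal.ofReal_toReal_le

/-- Jensen's inequality, by integrating the tangent line of exp at the mean; the right-hand side may
be infinite. -/
theorem exp_integral_le_lintegral {T : Type*} [MeasurableSpace T] {ρ : Measure T}
    [IsProbabilityMeasure ρ] {u : T → ℝ} (hu : Integrable u ρ) :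
    ENNReal.ofReal (Real.exp (∫ t, u t ∂ρ)) ≤ ∫⁻ t, ENNReal.ofReal (Real.exp (u t)) ∂ρ := by
  set m := ∫ t, u t ∂ρ with hm
  have hv : Integrable (fun t => Real.exp m * (u t + (1 - m))) ρ :=
    (hu.add (integrable_const _)).const_mul _
  have hint : ∫ t, Real.exp m * (u t + (1 - m)) ∂ρ = Real.exp m := by
    rw [integral_const_mul, integral_add hu (integrable_const _), integral_const, ← hm]
    simp
  calc _ = ENNReal.ofReal (∫ t, Real.exp m * (u t + (1 - m)) ∂ρ) := by rw [hint]
    _ ≤ ∫⁻ t, ENNReal.ofReal (Real.exp m * (u t + (1 - m))) ∂ρ := ofReal_integral_le_lintegral hv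
    _ ≤ _ := by
        refine lintegral_mono fun t => ENNReal.ofReal_le_ofReal ?_
        have h := Real.add_one_le_exp (u t - m)
        calc _ ≤ Real.exp m * Real.exp (u t - m) := by
              gcongr
              linarith
          _ = _ := by rw [← Real.exp_add]; ring_nf

theorem modelDensity_eq {d : ℕ} (θ : Vec d) (σ : ℝ) (z : ℝ × Vec d) :
    modelDensity θ σ z = (√(2 * Real.pi * σ ^ 2))⁻¹ *
      Real.exp (-((σ ^ 2)⁻¹ / 2 * (z.1 - inner ℝ z.2 θ) ^ 2)) := by
  unfold modelDensity gaussianPDFReal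
  rw [Real.coe_toNNReal _ (sq_nonneg σ)]
  congr 2
  rw [mul_comm 2, neg_div, ← div_div, div_eq_mul_inv _ (σ ^ 2)]
  ring

/-- Since σ ≤ σ₀, the Gaussian normalising factor at σ is at least the one at σ₀ and can be dropped.
This is why the precision window lies on one side of σ₀⁻². -/
theorem modelDensity_add_ge {d : ℕ} (θ₀ δ : Vec d) {σ σ₀ : ℝ} (hσ : 0 < σ) (hσ₀ : 0 < σ₀)
    (h : (σ₀ ^ 2)⁻¹ ≤ (σ ^ 2)⁻¹) (z : ℝ × Vec d) :
    modelDensity θ₀ σ₀ z * Real.exp ((σ₀ ^ 2)⁻¹ / 2 * (z.1 - inner ℝ z.2 θ₀) ^ 2 -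
      (σ ^ 2)⁻¹ / 2 * (z.1 - inner ℝ z.2 θ₀ - inner ℝ z.2 δ) ^ 2) ≤ modelDensity (θ₀ + δ) σ z := by
  have hle : σ ^ 2 ≤ σ₀ ^ 2 := (inv_le_inv₀ (by positivity) (by positivity)).1 h
  rw [modelDensity_eq, modelDensity_eq, mul_assoc, ← Real.exp_add, inner_add_right, ← sub_sub]
  have e : ∀ a b : ℝ, -a + (a - b) = -b := fun a b => by ring
  rw [e]
  gcongr

/-- The dominating function for the averaged log-likelihood ratio around the truth. -/
noncomputable def excess {d : ℕ} (n : ℕ) (M : ℝ) (θ₀ : Vec d) (σ₀ : ℝ) (z : ℝ × Vec d) : ℝ :=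
  (σ₀ ^ 2)⁻¹ / (2 * n) * (z.1 - inner ℝ z.2 θ₀) ^ 2 + 2 * (σ₀ ^ 2)⁻¹ * M * ‖z.2‖ ^ 2

theorem excess_nonneg {d : ℕ} (n : ℕ) {M : ℝ} (hM : 0 ≤ M) (θ₀ : Vec d) (σ₀ : ℝ) (z : ℝ × Vec d) :
    0 ≤ excess n M θ₀ σ₀ z := by
  unfold excess
  positivity

theorem measurable_excess {d : ℕ} (n : ℕ) (M : ℝ) (θ₀ : Vec d) (σ₀ : ℝ) :
    Measurable (excess n M θ₀ σ₀) := by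
  unfold excess
  fun_prop

theorem memLp_inner_of_lintegral_le {d : ℕ} {ρ : Measure (Vec d)} {x : Vec d} {B : ℝ}
    (h : ∫⁻ δ, ENNReal.ofReal (inner ℝ x δ ^ 2) ∂ρ ≤ ENNReal.ofReal B) :
    MemLp (fun δ => (inner ℝ x δ : ℝ)) 2 ρ := by
  rw [memLp_two_iff_integrable_sq (by fun_prop)]
  refine ⟨by fun_prop, ?_⟩
  rw [hasFiniteIntegral_iff_ofReal (ae_of_all _ fun _ => sq_nonneg _)]
  exact h.trans_lt ENNReal.ofReal_lt_top

theorem integral_sq_inner_le {d : ℕ} {ρ : Measure (Vec d)} {x : Vec d} {B : ℝ} (hB : 0 ≤ B)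
    (h : ∫⁻ δ, ENNReal.ofReal (inner ℝ x δ ^ 2) ∂ρ ≤ ENNReal.ofReal B) :
    ∫ δ, (inner ℝ x δ : ℝ) ^ 2 ∂ρ ≤ B := by
  rw [← ENNReal.ofReal_le_ofReal_iff hB, ofReal_integral_eq_lintegral_ofReal
    (memLp_inner_of_lintegral_le h).integrable_sq (ae_of_all _ fun _ => sq_nonneg _)]
  exact h

theorem integral_inner_eq_zero {d : ℕ} {ρ : Measure (Vec d)} (x : Vec d)
    (hneg : MeasurePreserving (fun δ => -δ) ρ ρ) : ∫ δ, (inner ℝ x δ : ℝ) ∂ρ = 0 := by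
  have h := hneg.integral_comp (MeasurableEquiv.neg (Vec d)).measurableEmbedding
    (fun δ => (inner ℝ x δ : ℝ))
  simp only [inner_neg_right, integral_neg] at h
  linarith

/-- The log-likelihood ratio averaged over a symmetric perturbation of the truth. -/
theorem neg_sum_excess_le_integral {n d : ℕ} (hn : 1 ≤ n) {ρ : Measure (Vec d)} [IsProbabilityMeasure ρ]
    (hneg : MeasurePreserving (fun δ => -δ) ρ ρ) {M : ℝ} (hM : 0 ≤ M)
    (hρ : ∀ x : Vec d, ∫⁻ δ, ENNReal.ofReal (inner ℝ x δ ^ 2) ∂ρ ≤ ENNReal.ofReal (2 * M * ‖x‖ ^ 2))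
    (θ₀ : Vec d) {σ σ₀ : ℝ} (hσ : σ ∈ precisionWindow (σ₀ ^ 2)⁻¹ n) (z : ℝ × Vec d) :
    Integrable (fun δ => (σ₀ ^ 2)⁻¹ / 2 * (z.1 - inner ℝ z.2 θ₀) ^ 2 -
      (σ ^ 2)⁻¹ / 2 * (z.1 - inner ℝ z.2 θ₀ - inner ℝ z.2 δ) ^ 2) ρ ∧
    -excess n M θ₀ σ₀ z ≤ ∫ δ, ((σ₀ ^ 2)⁻¹ / 2 * (z.1 - inner ℝ z.2 θ₀) ^ 2 -
      (σ ^ 2)⁻¹ / 2 * (z.1 - inner ℝ z.2 θ₀ - inner ℝ z.2 δ) ^ 2) ∂ρ := by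
  set g₀ := (σ₀ ^ 2)⁻¹ with hg₀
  set g := (σ ^ 2)⁻¹ with hg
  set e : ℝ := z.1 - inner ℝ z.2 θ₀ with he
  obtain ⟨-, h1, h2⟩ := hσ
  have hg₀0 : 0 ≤ g₀ := by positivity
  have hmem := memLp_inner_of_lintegral_le (hρ z.2)
  have hi1 : Integrable (fun δ => (inner ℝ z.2 δ : ℝ)) ρ := hmem.integrable one_le_two
  have hi2 := hmem.integrable_sq
  -- After expansion of the square, the only term linear in δ is g e ⟨x, δ⟩, which the symmetry of ρ
  -- integrates to zero.
  have hrw : (fun δ => g₀ / 2 * e ^ 2 - g / 2 * (e - inner ℝ z.2 δ) ^ 2) = fun δ =>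
      (g₀ - g) / 2 * e ^ 2 + g * e * inner ℝ z.2 δ - g / 2 * (inner ℝ z.2 δ : ℝ) ^ 2 := by
    ext δ
    ring
  rw [hrw]
  have hia : Integrable (fun δ => (g₀ - g) / 2 * e ^ 2 + g * e * inner ℝ z.2 δ) ρ :=
    (integrable_const _).add (hi1.const_mul _)
  refine ⟨hia.sub (hi2.const_mul _), ?_⟩
  rw [integral_sub hia (hi2.const_mul _), integral_add (integrable_const _) (hi1.const_mul _),
    integral_const_mul (g * e), integral_const_mul (g / 2), integral_inner_eq_zero z.2 hneg,
    integral_const]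
  have hq := integral_sq_inner_le (by positivity) (hρ z.2)
  have hq0 : 0 ≤ ∫ δ, (inner ℝ z.2 δ : ℝ) ^ 2 ∂ρ := integral_nonneg fun _ => sq_nonneg _
  simp only [probReal_univ, one_smul, mul_zero, add_zero]
  have hn' : (1 : ℝ) ≤ n := by exact_mod_cast hn
  have hn1 : 1 / (n : ℝ) ≤ 1 := (div_le_one (by linarith)).2 hn'
  have hg2 : g ≤ 2 * g₀ := h2.trans (by nlinarith)
  have hA : (g - g₀) / 2 * e ^ 2 ≤ g₀ / (2 * n) * e ^ 2 := by
    gcongr ?_ * _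
    have : g₀ / (2 * n) = g₀ * (1 / n) / 2 := by field_simp
    rw [this]
    linarith
  have hB : g / 2 * ∫ δ, (inner ℝ z.2 δ : ℝ) ^ 2 ∂ρ ≤ 2 * g₀ * M * ‖z.2‖ ^ 2 := by
    calc _ ≤ (2 * g₀) / 2 * (2 * M * ‖z.2‖ ^ 2) := by gcongr
      _ = _ := by ring
  unfold excess
  rw [← hg₀, ← he]
  linarith

theorem likelihood_pos {n d : ℕ} (z : Fin n → ℝ × Vec d) (θ : Vec d) {σ : ℝ} (hσ : 0 < σ) :
    0 < likelihood z θ σ :=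
  Finset.prod_pos fun i _ => modelDensity_pos θ hσ (z i)

theorem measurable_likelihood_uncurry {n d : ℕ} (z : Fin n → ℝ × Vec d) :
    Measurable fun p : Vec d × ℝ => likelihood z p.1 p.2 := by
  unfold likelihood modelDensity gaussianPDFReal
  fun_prop

theorem measurable_likelihood {n d : ℕ} (z : Fin n → ℝ × Vec d) (σ : ℝ) :
    Measurable fun θ : Vec d => likelihood z θ σ := by
  unfold likelihood modelDensity gaussianPDFReal
  fun_prop

/-- The fractional likelihood averaged over a symmetric perturbation of the truth. -/
theorem le_lintegral_likelihood {n d : ℕ} (hn : 1 ≤ n) {α : ℝ} (h0 : 0 < α) {ρ : Measure (Vec d)}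
    [IsProbabilityMeasure ρ] (hneg : MeasurePreserving (fun δ => -δ) ρ ρ) {M : ℝ} (hM : 0 ≤ M)
    (hρ : ∀ x : Vec d, ∫⁻ δ, ENNReal.ofReal (inner ℝ x δ ^ 2) ∂ρ ≤ ENNReal.ofReal (2 * M * ‖x‖ ^ 2))
    (θ₀ : Vec d) {σ σ₀ : ℝ} (hσ₀ : 0 < σ₀) (hσ : σ ∈ precisionWindow (σ₀ ^ 2)⁻¹ n)
    (z : Fin n → ℝ × Vec d) :
    ENNReal.ofReal (likelihood z θ₀ σ₀ ^ α * Real.exp (-(α * ∑ i, excess n M θ₀ σ₀ (z i)))) ≤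
      ∫⁻ δ, ENNReal.ofReal (likelihood z (θ₀ + δ) σ ^ α) ∂ρ := by
  have hσpos : 0 < σ := hσ.1
  have hL0 := likelihood_pos z θ₀ hσ₀
  set u : Fin n → Vec d → ℝ := fun i δ => (σ₀ ^ 2)⁻¹ / 2 * ((z i).1 - inner ℝ (z i).2 θ₀) ^ 2 -
      (σ ^ 2)⁻¹ / 2 * ((z i).1 - inner ℝ (z i).2 θ₀ - inner ℝ (z i).2 δ) ^ 2 with hu
  have hui := fun i => neg_sum_excess_le_integral hn hneg hM hρ θ₀ hσ (z i)
  have hsum : Integrable (fun δ => ∑ i, u i δ) ρ := integrable_finsetSum _ fun i _ => (hui i).1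
  have hlow : -∑ i, excess n M θ₀ σ₀ (z i) ≤ ∫ δ, ∑ i, u i δ ∂ρ := by
    rw [integral_finsetSum _ fun i _ => (hui i).1, ← Finset.sum_neg_distrib]
    exact Finset.sum_le_sum fun i _ => (hui i).2
  have hpt : ∀ δ, likelihood z θ₀ σ₀ ^ α * Real.exp (α * ∑ i, u i δ) ≤ likelihood z (θ₀ + δ) σ ^ α := by
    intro δ
    have h1 : likelihood z θ₀ σ₀ * Real.exp (∑ i, u i δ) ≤ likelihood z (θ₀ + δ) σ := by
      unfold likelihood
      rw [Real.exp_sum, ← Finset.prod_mul_distrib]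
      exact Finset.prod_le_prod (fun i _ => mul_nonneg (modelDensity_pos θ₀ hσ₀ _).le (Real.exp_pos _).le)
        fun i _ => modelDensity_add_ge θ₀ δ hσpos hσ₀ hσ.2.1 (z i)
    have h2 := Real.rpow_le_rpow (by positivity) h1 h0.le
    rwa [Real.mul_rpow hL0.le (Real.exp_pos _).le, ← Real.exp_mul, mul_comm _ α] at h2
  calc _ ≤ ENNReal.ofReal (likelihood z θ₀ σ₀ ^ α * Real.exp (∫ δ, α * ∑ i, u i δ ∂ρ)) := by
        rw [integral_const_mul, ← mul_neg]
        gcongr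
    _ ≤ ENNReal.ofReal (likelihood z θ₀ σ₀ ^ α) * ∫⁻ δ, ENNReal.ofReal (Real.exp (α * ∑ i, u i δ)) ∂ρ := by
        rw [ENNReal.ofReal_mul (by positivity)]
        gcongr
        exact exp_integral_le_lintegral (hsum.const_mul α)
    _ ≤ _ := by
        rw [← lintegral_const_mul' _ _ ENNReal.ofReal_ne_top]
        refine lintegral_mono fun δ => ?_
        rw [← ENNReal.ofReal_mul (by positivity)]
        exact ENNReal.ofReal_le_ofReal (hpt δ)

/-- A lower bound on the evidence of the fractional posterior. -/
theorem le_lintegral_prior {n d : ℕ} (hn : 1 ≤ n) {α τ C₁ a b κ κσ : ℝ} (h0 : 0 < α)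
    (ha : 0 < a) (hb : 0 < b) {ρ : Measure (Vec d)}
    [IsProbabilityMeasure ρ] (hneg : MeasurePreserving (fun δ => -δ) ρ ρ) {M : ℝ} (hM : 0 ≤ M)
    (hρ : ∀ x : Vec d, ∫⁻ δ, ENNReal.ofReal (inner ℝ x δ ^ 2) ∂ρ ≤ ENNReal.ofReal (2 * M * ‖x‖ ^ 2))
    (θ₀ : Vec d) {σ₀ : ℝ} (hσ₀ : 0 < σ₀)
    (hκ : ∀ φ : Vec d → ℝ≥0∞, Measurable φ →
      ENNReal.ofReal κ * ∫⁻ δ, φ (θ₀ + δ) ∂ρ ≤ ∫⁻ θ, φ θ ∂(thetaPrior d τ C₁))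
    (hκσ : ENNReal.ofReal κσ ≤ sigmaPrior a b (precisionWindow (σ₀ ^ 2)⁻¹ n))
    (hκ0 : 0 ≤ κ) (hκσ0 : 0 ≤ κσ) [IsProbabilityMeasure (thetaPrior d τ C₁)]
    (z : Fin n → ℝ × Vec d) :
    ENNReal.ofReal (κσ * κ * (likelihood z θ₀ σ₀ ^ α *
      Real.exp (-(α * ∑ i, excess n M θ₀ σ₀ (z i))))) ≤
      ∫⁻ p, ENNReal.ofReal (likelihood z p.1 p.2 ^ α) ∂(prior d τ C₁ a b) := by
  have := isProbabilityMeasure_sigmaPrior ha hb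
  have hL0 := likelihood_pos z θ₀ hσ₀
  have hm := measurable_likelihood_uncurry z
  have hm2 : Measurable fun p : Vec d × ℝ => ENNReal.ofReal (likelihood z p.1 p.2 ^ α) :=
    (hm.pow_const α).ennreal_ofReal
  unfold prior
  rw [lintegral_prod_symm _ hm2.aemeasurable]
  set A := likelihood z θ₀ σ₀ ^ α * Real.exp (-(α * ∑ i, excess n M θ₀ σ₀ (z i))) with hA
  have hApos : 0 < A := by positivity
  calc _ ≤ ∫⁻ _σ in precisionWindow (σ₀ ^ 2)⁻¹ n, ENNReal.ofReal κ * ENNReal.ofReal A ∂(sigmaPrior a b) := by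
        rw [setLIntegral_const, mul_assoc κσ, ENNReal.ofReal_mul hκσ0, ENNReal.ofReal_mul hκ0, mul_comm]
        gcongr
    _ ≤ ∫⁻ σ in precisionWindow (σ₀ ^ 2)⁻¹ n, ∫⁻ θ, ENNReal.ofReal (likelihood z θ σ ^ α)
          ∂(thetaPrior d τ C₁) ∂(sigmaPrior a b) := by
        refine setLIntegral_mono' (measurableSet_precisionWindow _ n) fun σ hσ => ?_
        have hmθ := measurable_likelihood z σ
        have h1 := hκ (fun θ => ENNReal.ofReal (likelihood z θ σ ^ α)) (hmθ.pow_const α).ennreal_ofReal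
        have h2 := le_lintegral_likelihood hn h0 hneg hM hρ θ₀ hσ₀ hσ z
        exact (mul_le_mul_right h2 (ENNReal.ofReal κ)).trans h1
    _ ≤ _ := setLIntegral_le_lintegral _ _

/-! ### Mean of the excess -/

theorem lintegral_sq_gaussianReal (v : ℝ≥0) :
    ∫⁻ e, ENNReal.ofReal (e ^ 2) ∂(gaussianReal 0 v) = ENNReal.ofReal v := by
  have h := variance_fun_id_gaussianReal (μ := 0) (v := v)
  rw [variance_of_integral_eq_zero (by fun_prop) integral_id_gaussianReal] at h
  rw [← ofReal_integral_eq_lintegral_ofReal, h]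
  · exact (memLp_id_gaussianReal 2).integrable_sq
  · exact ae_of_all _ fun _ => sq_nonneg _

/-- The noise part has mean σ₀⁻²σ₀²/(2n) = 1/(2n), and `hMn` bounds the covariate part by another
1/(2n). -/
theorem lintegral_excess_le {n d : ℕ} (hn : 1 ≤ n) (Q : Measure (Vec d)) [IsProbabilityMeasure Q]
    {M Cx : ℝ} (hM : 0 ≤ M) (hQ : Integrable (fun x => ‖x‖ ^ 2) Q) (hQ2 : ∫ x, ‖x‖ ^ 2 ∂Q ≤ Cx ^ 2)
    (θ₀ : Vec d) {σ₀ : ℝ} (hσ₀ : 0 < σ₀) (hMn : 2 * (σ₀ ^ 2)⁻¹ * M * Cx ^ 2 ≤ 1 / (2 * n)) :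
    ∫⁻ z, ENNReal.ofReal (excess n M θ₀ σ₀ z) ∂(modelLaw Q θ₀ σ₀) ≤ ENNReal.ofReal (1 / n) := by
  have hn' : (0 : ℝ) < n := by exact_mod_cast hn
  rw [modelLaw, lintegral_map (measurable_excess n M θ₀ σ₀).ennreal_ofReal (by fun_prop)]
  have e : ∀ p : Vec d × ℝ, ENNReal.ofReal (excess n M θ₀ σ₀ (inner ℝ p.1 θ₀ + p.2, p.1)) =
      ENNReal.ofReal ((σ₀ ^ 2)⁻¹ / (2 * n)) * ENNReal.ofReal (p.2 ^ 2) +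
      ENNReal.ofReal (2 * (σ₀ ^ 2)⁻¹ * M) * ENNReal.ofReal (‖p.1‖ ^ 2) := by
    intro p
    rw [← ENNReal.ofReal_mul (by positivity), ← ENNReal.ofReal_mul (by positivity),
      ← ENNReal.ofReal_add (by positivity) (by positivity), excess, add_sub_cancel_left]
  simp_rw [e]
  rw [lintegral_add_left (by fun_prop), lintegral_const_mul _ (by fun_prop),
    lintegral_const_mul _ (by fun_prop)]
  have h1 : ∫⁻ p : Vec d × ℝ, ENNReal.ofReal (p.2 ^ 2) ∂(Q.prod (gaussianReal 0 (σ₀ ^ 2).toNNReal)) =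
      ENNReal.ofReal (σ₀ ^ 2) := by
    rw [(measurePreserving_snd (μ := Q) (ν := gaussianReal 0 (σ₀ ^ 2).toNNReal)).lintegral_comp
      (f := fun e : ℝ => ENNReal.ofReal (e ^ 2)) (by fun_prop), lintegral_sq_gaussianReal,
      Real.coe_toNNReal _ (sq_nonneg _)]
  have h2 : ∫⁻ p : Vec d × ℝ, ENNReal.ofReal (‖p.1‖ ^ 2) ∂(Q.prod (gaussianReal 0 (σ₀ ^ 2).toNNReal)) ≤
      ENNReal.ofReal (Cx ^ 2) := by
    rw [(measurePreserving_fst (μ := Q) (ν := gaussianReal 0 (σ₀ ^ 2).toNNReal)).lintegral_comp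
      (f := fun x : Vec d => ENNReal.ofReal (‖x‖ ^ 2)) (by fun_prop),
      ← ofReal_integral_eq_lintegral_ofReal hQ (ae_of_all _ fun _ => sq_nonneg _)]
    exact ENNReal.ofReal_le_ofReal hQ2
  rw [h1]
  calc _ ≤ ENNReal.ofReal ((σ₀ ^ 2)⁻¹ / (2 * n)) * ENNReal.ofReal (σ₀ ^ 2) +
        ENNReal.ofReal (2 * (σ₀ ^ 2)⁻¹ * M) * ENNReal.ofReal (Cx ^ 2) := by gcongr
    _ = ENNReal.ofReal (1 / (2 * n) + 2 * (σ₀ ^ 2)⁻¹ * M * Cx ^ 2) := by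
        rw [← ENNReal.ofReal_mul (by positivity), ← ENNReal.ofReal_mul (by positivity),
          ← ENNReal.ofReal_add (by positivity) (by positivity)]
        congr 2
        field_simp
    _ ≤ _ := by
        apply ENNReal.ofReal_le_ofReal
        have : 1 / (n : ℝ) = 1 / (2 * n) + 1 / (2 * n) := by field_simp; norm_num
        linarith

/-! ### From the ratio integral to the posterior risk -/

/-- The product of normalised fractional likelihood ratios, integrated against the prior. -/
noncomputable def ratioIntegral {n d : ℕ} (α : ℝ) (Q : Measure (Vec d)) (θ₀ : Vec d) (σ₀ : ℝ)
    (π : Measure (Vec d × ℝ)) (z : Fin n → ℝ × Vec d) : ℝ≥0∞ :=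
  ∫⁻ p, (∏ i, ENNReal.ofReal ((modelDensity p.1 p.2 (z i) / modelDensity θ₀ σ₀ (z i)) ^ α)) *
    (affinity α Q θ₀ σ₀ p)⁻¹ ^ n ∂π

theorem measurable_ratio {d : ℕ} (α : ℝ) (θ₀ : Vec d) (σ₀ : ℝ) :
    Measurable fun q : (Vec d × ℝ) × (ℝ × Vec d) =>
      ENNReal.ofReal ((modelDensity q.1.1 q.1.2 q.2 / modelDensity θ₀ σ₀ q.2) ^ α) := by
  have hm := measurable_modelDensity_uncurry (d := d)
  have hm₀ := measurable_modelDensity θ₀ σ₀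
  fun_prop

theorem measurable_lintegral_normalized_prod {Z T : Type*} [MeasurableSpace Z] [MeasurableSpace T]
    (P : Measure Z) [IsProbabilityMeasure P] (π : Measure T) [IsProbabilityMeasure π] (n : ℕ)
    {r : T × Z → ℝ≥0∞} (hr : Measurable r) :
    Measurable fun z : Fin n → Z => ∫⁻ t, (∏ i, r (t, z i)) * (∫⁻ w, r (t, w) ∂P)⁻¹ ^ n ∂π := by
  have hH : Measurable fun t => ∫⁻ w, r (t, w) ∂P := hr.lintegral_prod_right'
  have hri : ∀ i : Fin n, Measurable fun q : (Fin n → Z) × T => r (q.2, q.1 i) := fun i =>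
    hr.comp (by fun_prop)
  have hprod : Measurable fun q : (Fin n → Z) × T => ∏ i, r (q.2, q.1 i) :=
    Finset.measurable_prod _ fun i _ => hri i
  exact (hprod.mul ((hH.inv.pow_const n).comp measurable_snd)).lintegral_prod_right'

theorem measurable_ratioIntegral {n d : ℕ} (α : ℝ) (Q : Measure (Vec d)) [IsProbabilityMeasure Q]
    (θ₀ : Vec d) (σ₀ : ℝ) (π : Measure (Vec d × ℝ)) [IsProbabilityMeasure π] :
    Measurable (ratioIntegral (n := n) α Q θ₀ σ₀ π) := by
  have := isProbabilityMeasure_modelLaw Q θ₀ σ₀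
  exact measurable_lintegral_normalized_prod (modelLaw Q θ₀ σ₀) π n (measurable_ratio α θ₀ σ₀)

theorem lintegral_ratioIntegral_le {n d : ℕ} (α : ℝ) (Q : Measure (Vec d)) [IsProbabilityMeasure Q]
    (θ₀ : Vec d) (σ₀ : ℝ) (π : Measure (Vec d × ℝ)) [IsProbabilityMeasure π] :
    ∫⁻ z, ratioIntegral (n := n) α Q θ₀ σ₀ π z ∂(Measure.pi fun _ => modelLaw Q θ₀ σ₀) ≤ 1 := by
  have := isProbabilityMeasure_modelLaw Q θ₀ σ₀
  exact lintegral_normalized_prod_le_one (modelLaw Q θ₀ σ₀) π n (measurable_ratio α θ₀ σ₀)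

/-- Identifies the unnormalised exponential moment of n(1-α)D_α under the posterior with L₀^α times
the ratio integral, whose mean is controlled. -/
theorem lintegral_likelihood_mul_exp {n d : ℕ} {α : ℝ} (h0 : 0 < α) (h1 : α < 1) (Q : Measure (Vec d))
    [IsProbabilityMeasure Q] (θ₀ : Vec d) {σ₀ : ℝ} (hσ₀ : 0 < σ₀) {π : Measure (Vec d × ℝ)}
    (hπ : ∀ᵐ p ∂π, 0 < p.2) (z : Fin n → ℝ × Vec d) :
    ∫⁻ p, ENNReal.ofReal (likelihood z p.1 p.2 ^ α) *
      ENNReal.ofReal (Real.exp (n * -Real.log (affinity α Q θ₀ σ₀ p).toReal)) ∂π =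
      ENNReal.ofReal (likelihood z θ₀ σ₀ ^ α) * ratioIntegral α Q θ₀ σ₀ π z := by
  rw [ratioIntegral, ← lintegral_const_mul' _ _ ENNReal.ofReal_ne_top]
  refine lintegral_congr_ae ?_
  filter_upwards [hπ] with p hp
  have hne := affinity_ne_zero α Q p.1 θ₀ hp hσ₀
  have htop : affinity α Q θ₀ σ₀ p ≠ ∞ :=
    ((affinity_le_one h0 h1 Q p.1 θ₀ hp hσ₀).trans_lt ENNReal.one_lt_top).ne
  have hpos : 0 < (affinity α Q θ₀ σ₀ p).toReal := ENNReal.toReal_pos hne htop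
  have hL₀ := likelihood_pos z θ₀ hσ₀
  have hexp : ENNReal.ofReal (Real.exp (n * -Real.log (affinity α Q θ₀ σ₀ p).toReal)) =
      (affinity α Q θ₀ σ₀ p)⁻¹ ^ n := by
    rw [Real.exp_nat_mul, Real.exp_neg, Real.exp_log hpos, ENNReal.ofReal_pow (by positivity),
      ENNReal.ofReal_inv_of_pos hpos, ENNReal.ofReal_toReal htop]
  have hprod : ∏ i, ENNReal.ofReal ((modelDensity p.1 p.2 (z i) / modelDensity θ₀ σ₀ (z i)) ^ α) =
      ENNReal.ofReal ((likelihood z p.1 p.2 / likelihood z θ₀ σ₀) ^ α) := by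
    rw [← ENNReal.ofReal_prod_of_nonneg fun i _ => Real.rpow_nonneg
      (div_nonneg (modelDensity_pos _ hp _).le (modelDensity_pos _ hσ₀ _).le) _,
      Real.finsetProd_rpow _ _ fun i _ =>
        div_nonneg (modelDensity_pos _ hp _).le (modelDensity_pos _ hσ₀ _).le,
      Finset.prod_div_distrib]
    rfl
  rw [hexp, hprod, ← mul_assoc, ← ENNReal.ofReal_mul (by positivity),
    Real.div_rpow (likelihood_pos z p.1 hp).le hL₀.le, mul_div_cancel₀ _ (by positivity)]

/-- The deterministic part of the argument: the posterior risk bound holds on the event that the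
ratio integral and the total excess are both smaller than the rate. -/
theorem lintegral_renyiDiv_le {n d : ℕ} (hn : 1 ≤ n) {α τ C₁ a b κ M R : ℝ} (h0 : 0 < α) (h1 : α < 1)
    (hτ : 0 < τ) (hC : 0 < C₁) (ha : 0 < a) (hb : 0 < b) (Q : Measure (Vec d)) [IsProbabilityMeasure Q]
    (θ₀ : Vec d) {σ₀ : ℝ} (hσ₀ : 0 < σ₀) (hR : 0 < R) (hκ : Real.exp (-R) ≤ κ)
    (z : Fin n → ℝ × Vec d)
    (hev : ENNReal.ofReal (κ * (likelihood z θ₀ σ₀ ^ α *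
      Real.exp (-(α * ∑ i, excess n M θ₀ σ₀ (z i))))) ≤
      ∫⁻ p, ENNReal.ofReal (likelihood z p.1 p.2 ^ α) ∂(prior d τ C₁ a b))
    (hV : ratioIntegral α Q θ₀ σ₀ (prior d τ C₁ a b) z ≤ ENNReal.ofReal R)
    (hF : ∑ i, excess n M θ₀ σ₀ (z i) ≤ R) :
    ∫⁻ p, (renyiDiv α (modelLaw Q p.1 p.2) (modelLaw Q θ₀ σ₀)).toENNReal
        ∂(fracPosterior α (prior d τ C₁ a b) z) ≤
      ENNReal.ofReal ((n * (1 - α))⁻¹ * (2 * (α + 1) * R)) := by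
  have := isProbabilityMeasure_thetaPrior d hτ hC
  have := isProbabilityMeasure_sigmaPrior ha hb
  have hpos : ∀ᵐ p ∂(prior d τ C₁ a b), 0 < p.2 :=
    Measure.quasiMeasurePreserving_snd.ae sigmaPrior_pos
  have hn' : (0 : ℝ) < n := by exact_mod_cast hn
  have h1α : 0 < 1 - α := by linarith
  have hL₀ := likelihood_pos z θ₀ hσ₀
  have hκ0 : 0 < κ := (Real.exp_pos _).trans_le hκ
  set w : Vec d × ℝ → ℝ≥0∞ := fun p => ENNReal.ofReal (likelihood z p.1 p.2 ^ α) with hw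
  have hwm : Measurable w := ((measurable_likelihood_uncurry z).pow_const α).ennreal_ofReal
  set f : Vec d × ℝ → ℝ := fun p => n * -Real.log (affinity α Q θ₀ σ₀ p).toReal with hf
  have hfm : Measurable f :=
    ((Real.measurable_log.comp (measurable_affinity α Q θ₀ σ₀).ennreal_toReal).neg).const_mul _
  have hprob := isProbabilityMeasure_fracPosterior h0 h1 hτ hC ha hb z
  have huniv : (prior d τ C₁ a b).withDensity w Set.univ = ∫⁻ p, w p ∂(prior d τ C₁ a b) := by
    rw [withDensity_apply _ MeasurableSet.univ, Measure.restrict_univ]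
  -- In `ℝ≥0∞` the identity x⁻¹ x = 1 excludes both x = 0 and x = ∞.
  have htot : (∫⁻ p, w p ∂(prior d τ C₁ a b))⁻¹ * ∫⁻ p, w p ∂(prior d τ C₁ a b) = 1 := by
    have h := hprob.measure_univ
    rw [fracPosterior, normalize, Measure.smul_apply, smul_eq_mul, huniv] at h
    exact h
  have hZ0 : ∫⁻ p, w p ∂(prior d τ C₁ a b) ≠ 0 := fun h => by
    rw [h, mul_zero] at htot
    exact zero_ne_one htot
  have hZtop : ∫⁻ p, w p ∂(prior d τ C₁ a b) ≠ ∞ := fun h => by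
    rw [h, ENNReal.inv_top, zero_mul] at htot
    exact zero_ne_one htot
  have hf0 : ∀ᵐ p ∂(prior d τ C₁ a b), 0 ≤ f p := by
    filter_upwards [hpos] with p hp
    have hle := ENNReal.toReal_mono ENNReal.one_ne_top (affinity_le_one h0 h1 Q p.1 θ₀ hp hσ₀)
    have := Real.log_nonpos ENNReal.toReal_nonneg hle
    exact mul_nonneg hn'.le (neg_nonneg.2 this)
  have hm : 0 ≤ 2 * (α + 1) * R := by positivity
  have hexp : ∫⁻ p, w p * ENNReal.ofReal (Real.exp (f p)) ∂(prior d τ C₁ a b) ≤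
      ENNReal.ofReal (Real.exp (2 * (α + 1) * R)) * ∫⁻ p, w p ∂(prior d τ C₁ a b) := by
    rw [lintegral_likelihood_mul_exp h0 h1 Q θ₀ hσ₀ hpos z]
    -- One factor e^{(α+1)R} absorbs R ≤ e^R; the other pays for the prior mass e^{-R} and the
    -- excess e^{-αR}. Together they give the constant 2(α+1).
    have hnum : likelihood z θ₀ σ₀ ^ α * R ≤ Real.exp (2 * (α + 1) * R) *
        (κ * (likelihood z θ₀ σ₀ ^ α * Real.exp (-(α * ∑ i, excess n M θ₀ σ₀ (z i))))) := by
      have hR1 : R ≤ Real.exp R := by linarith [Real.add_one_le_exp R]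
      calc likelihood z θ₀ σ₀ ^ α * R ≤ likelihood z θ₀ σ₀ ^ α * Real.exp ((α + 1) * R) := by
            gcongr
            refine hR1.trans (Real.exp_le_exp.2 ?_)
            nlinarith
        _ = Real.exp (2 * (α + 1) * R) * (Real.exp (-R) *
              (likelihood z θ₀ σ₀ ^ α * Real.exp (-(α * R)))) := by
            have : Real.exp ((α + 1) * R) =
                Real.exp (2 * (α + 1) * R) * Real.exp (-R) * Real.exp (-(α * R)) := by
              rw [← Real.exp_add, ← Real.exp_add]
              congr 1
              ring
            rw [this]
            ring
        _ ≤ _ := by gcongr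
    calc _ ≤ ENNReal.ofReal (likelihood z θ₀ σ₀ ^ α) * ENNReal.ofReal R := mul_le_mul_right hV _
      _ = ENNReal.ofReal (likelihood z θ₀ σ₀ ^ α * R) := (ENNReal.ofReal_mul (by positivity)).symm
      _ ≤ _ := ENNReal.ofReal_le_ofReal hnum
      _ = _ := ENNReal.ofReal_mul (Real.exp_pos _).le
      _ ≤ _ := mul_le_mul_right hev _
  have hmain := lintegral_normalize_le_of_exp_le _ hwm hZ0 hZtop hfm hf0 hm hexp
  have hac : fracPosterior α (prior d τ C₁ a b) z ≪ prior d τ C₁ a b :=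
    (withDensity_absolutelyContinuous _ w).smul_left _
  calc _ = ∫⁻ p, ENNReal.ofReal ((n * (1 - α))⁻¹) * ENNReal.ofReal (f p)
        ∂(fracPosterior α (prior d τ C₁ a b) z) := by
        refine lintegral_congr_ae ?_
        filter_upwards [hac.ae_le hpos] with p hp
        rw [renyiDiv_modelLaw h0 h1 Q p.1 θ₀ hp hσ₀, ← ENNReal.ofReal_mul (by positivity)]
        congr 1
        simp only [hf]
        field_simp
    _ = ENNReal.ofReal ((n * (1 - α))⁻¹) * ∫⁻ p, ENNReal.ofReal (f p)
        ∂(fracPosterior α (prior d τ C₁ a b) z) := lintegral_const_mul' _ _ ENNReal.ofReal_ne_top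
    _ ≤ ENNReal.ofReal ((n * (1 - α))⁻¹) * ENNReal.ofReal (2 * (α + 1) * R) := mul_le_mul_right hmain _
    _ = _ := (ENNReal.ofReal_mul (by positivity)).symm

/-- Markov's inequality for the two exceptional events. -/
theorem measureReal_ge_of_compl_subset {Ω : Type*} [MeasurableSpace Ω] (P : Measure Ω)
    [IsProbabilityMeasure P] {V W : Ω → ℝ≥0∞} (hV : Measurable V) (hW : Measurable W)
    (hV1 : ∫⁻ z, V z ∂P ≤ 1) (hW1 : ∫⁻ z, W z ∂P ≤ 1) {R : ℝ} (hR : 0 < R) {A : Set Ω}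
    (hA : ∀ z, V z < ENNReal.ofReal R → W z < ENNReal.ofReal R → z ∈ A) :
    1 - 2 / R ≤ P.real A := by
  have hR0 : ENNReal.ofReal R ≠ 0 := (ENNReal.ofReal_pos.2 hR).ne'
  have hmk : ∀ U : Ω → ℝ≥0∞, Measurable U → ∫⁻ z, U z ∂P ≤ 1 →
      P.real {z | ENNReal.ofReal R ≤ U z} ≤ 1 / R := by
    intro U hU hU1
    have h := (meas_ge_le_lintegral_div hU.aemeasurable hR0 ENNReal.ofReal_ne_top).trans
      (ENNReal.div_le_div_right hU1 _)
    have h2 := ENNReal.toReal_mono (ENNReal.div_ne_top ENNReal.one_ne_top hR0) h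
    rwa [ENNReal.toReal_div, ENNReal.toReal_one, ENNReal.toReal_ofReal hR.le] at h2
  -- Covering the space by `A` and the two bad events uses only subadditivity, so `A` need not be
  -- measurable.
  have hcov : (Set.univ : Set Ω) ⊆
      A ∪ ({z | ENNReal.ofReal R ≤ V z} ∪ {z | ENNReal.ofReal R ≤ W z}) := by
    intro z _
    by_cases h1 : V z < ENNReal.ofReal R
    · by_cases h2 : W z < ENNReal.ofReal R
      · exact Or.inl (hA z h1 h2)
      · exact Or.inr (Or.inr (not_lt.1 h2))
    · exact Or.inr (Or.inl (not_lt.1 h1))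
  have h1 := measureReal_mono (μ := P) hcov
  have h2 := measureReal_union_le (μ := P) A ({z | ENNReal.ofReal R ≤ V z} ∪ {z | ENNReal.ofReal R ≤ W z})
  have h3 := measureReal_union_le (μ := P) {z | ENNReal.ofReal R ≤ V z} {z | ENNReal.ofReal R ≤ W z}
  have h4 := hmk V hV hV1
  have h5 := hmk W hW hW1
  rw [probReal_univ] at h1
  have : 2 / R = 1 / R + 1 / R := by ring
  linarith

theorem lintegral_sum_excess_le {n d : ℕ} (hn : 1 ≤ n) (P : Measure (ℝ × Vec d)) [IsProbabilityMeasure P]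
    {M : ℝ} (θ₀ : Vec d) (σ₀ : ℝ)
    (h : ∫⁻ z, ENNReal.ofReal (excess n M θ₀ σ₀ z) ∂P ≤ ENNReal.ofReal (1 / n)) :
    ∫⁻ z, ∑ i, ENNReal.ofReal (excess n M θ₀ σ₀ (z i)) ∂(Measure.pi fun _ : Fin n => P) ≤ 1 := by
  have hm := (measurable_excess n M θ₀ σ₀).ennreal_ofReal
  have hn' : (0 : ℝ) < n := by exact_mod_cast hn
  have hmi : ∀ i : Fin n, Measurable fun z : Fin n → ℝ × Vec d =>
      ENNReal.ofReal (excess n M θ₀ σ₀ (z i)) := fun i => hm.comp (measurable_pi_apply i)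
  rw [lintegral_finsetSum _ fun i _ => hmi i]
  calc _ ≤ ∑ _i : Fin n, ENNReal.ofReal (1 / n) := by
        refine Finset.sum_le_sum fun i _ => ?_
        rw [(measurePreserving_eval (fun _ : Fin n => P) i).lintegral_comp hm]
        exact h
    _ = 1 := by
        rw [Finset.sum_const, Finset.card_univ, Fintype.card_fin, nsmul_eq_mul, ← ENNReal.ofReal_natCast,
          ← ENNReal.ofReal_mul hn'.le, mul_one_div_cancel hn'.ne', ENNReal.ofReal_one]

/-! ### Logarithmic costs -/

/-- Concavity: sum the tangent bound log x ≤ log A + x/A - 1 over `S`. -/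
theorem sum_log_le_card_mul_log {ι : Type*} (S : Finset ι) {x : ι → ℝ} {A : ℝ} (hx : ∀ i ∈ S, 0 < x i)
    (hA : 0 < A) (h : ∑ i ∈ S, x i ≤ S.card * A) : ∑ i ∈ S, Real.log (x i) ≤ S.card * Real.log A := by
  have h1 : ∀ i ∈ S, Real.log (x i) ≤ Real.log A + (x i / A - 1) := by
    intro i hi
    have := Real.log_le_sub_one_of_pos (div_pos (hx i hi) hA)
    rw [Real.log_div (hx i hi).ne' hA.ne'] at this
    linarith
  refine (Finset.sum_le_sum h1).trans ?_
  rw [Finset.sum_add_distrib, Finset.sum_sub_distrib, ← Finset.sum_div]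
  simp only [Finset.sum_const, nsmul_eq_mul, mul_one]
  have : (∑ i ∈ S, x i) / A ≤ S.card := (div_le_iff₀ hA).2 h
  linarith

/-- The logarithm of a dimension is at most a multiple of `s log (2d / s)`. -/
theorem log_le_mul_of_log_div_le {s d : ℕ} {L : ℝ} (hs : 1 ≤ s) (hsd : s ≤ d)
    (hL : Real.log (2 * d / s) ≤ L) : Real.log 2 ≤ L ∧ Real.log d ≤ s * L / Real.log 2 := by
  have hs' : (1 : ℝ) ≤ s := by exact_mod_cast hs
  have hsd' : (s : ℝ) ≤ d := by exact_mod_cast hsd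
  have h2 : 0 < Real.log 2 := Real.log_pos one_lt_two
  have h2' : Real.log 2 ≤ 1 := by linarith [Real.log_le_sub_one_of_pos (two_pos (α := ℝ))]
  have hdiv : (2 : ℝ) ≤ 2 * d / s := by
    rw [le_div_iff₀ (by linarith)]
    linarith
  have hL2 : Real.log 2 ≤ L := (Real.log_le_log two_pos hdiv).trans hL
  refine ⟨hL2, ?_⟩
  have hlogs : Real.log s ≤ s - 1 := Real.log_le_sub_one_of_pos (by linarith)
  rw [Real.log_div (by linarith) (by linarith), Real.log_mul two_ne_zero (by linarith)] at hL
  rw [le_div_iff₀ h2]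
  nlinarith [mul_le_mul_of_nonneg_left hL2 (sub_nonneg.2 hs')]

/-- The cost of localising the prior on the coefficients. -/
theorem localization_cost_le {d : ℕ} (θ₀ : Vec d) {τ C₁ h D L : ℝ} (hτ : 0 < τ)
    (hs : 1 ≤ l0norm θ₀) (hsd : l0norm θ₀ ≤ d)
    (hl1 : l1norm θ₀ ≤ C₁ - 2 * d * τ) (hh : 0 < h) (h1 : h ≤ 1)
    (hL : L = Real.log (C₁ / (τ * l0norm θ₀))) (hL2 : Real.log 2 ≤ L)
    (I : Finset (Fin d)) (hI : (Finset.univ.filter fun i => θ₀ i ≠ 0) ⊆ I)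
    (hcard : (I.card : ℝ) ≤ D * l0norm θ₀) :
    0 < 2⁻¹ * ∏ i ∈ I, (h * ((2 + |θ₀ i| / τ) ^ 4)⁻¹) ∧
    -Real.log (2⁻¹ * ∏ i ∈ I, (h * ((2 + |θ₀ i| / τ) ^ 4)⁻¹)) ≤
      (5 + D * ((-Real.log h + 4 * Real.log 2) / Real.log 2)) * (l0norm θ₀ * L) := by
  set S := Finset.univ.filter fun i => θ₀ i ≠ 0 with hS
  have hsc : l0norm θ₀ = S.card := rfl
  have hs' : (1 : ℝ) ≤ l0norm θ₀ := by exact_mod_cast hs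
  have hsd' : (l0norm θ₀ : ℝ) ≤ d := by exact_mod_cast hsd
  have h2 : 0 < Real.log 2 := Real.log_pos one_lt_two
  have hx : ∀ i, 0 < 2 + |θ₀ i| / τ := fun i => by positivity
  have hlogh : 0 ≤ -Real.log h := neg_nonneg.2 (Real.log_nonpos hh.le h1)
  have hpos : ∀ i, 0 < h * ((2 + |θ₀ i| / τ) ^ 4)⁻¹ := fun i => by
    have := hx i
    positivity
  have hprod : 0 < ∏ i ∈ I, (h * ((2 + |θ₀ i| / τ) ^ 4)⁻¹) := Finset.prod_pos fun i _ => hpos i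
  refine ⟨by positivity, ?_⟩
  have hlog : -Real.log (2⁻¹ * ∏ i ∈ I, (h * ((2 + |θ₀ i| / τ) ^ 4)⁻¹)) =
      Real.log 2 + I.card * (-Real.log h) + 4 * ∑ i ∈ I, Real.log (2 + |θ₀ i| / τ) := by
    rw [Real.log_mul (by norm_num) hprod.ne', Real.log_inv, Real.log_prod fun i _ => (hpos i).ne']
    have : ∀ i ∈ I, Real.log (h * ((2 + |θ₀ i| / τ) ^ 4)⁻¹) =
        Real.log h - 4 * Real.log (2 + |θ₀ i| / τ) := by
      intro i _
      rw [Real.log_mul hh.ne' (inv_ne_zero (pow_ne_zero _ (hx i).ne')), Real.log_inv, Real.log_pow]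
      push_cast
      ring
    rw [Finset.sum_congr rfl this, Finset.sum_sub_distrib, Finset.sum_const, nsmul_eq_mul, Finset.mul_sum]
    ring
  -- The mean of 2 + |θ₀ᵢ|/τ over the support is at most C₁/(τs), since 2sτ + ‖θ₀‖₁ ≤ 2dτ + ‖θ₀‖₁ ≤
  -- C₁.
  have hsumS : ∑ i ∈ S, Real.log (2 + |θ₀ i| / τ) ≤ l0norm θ₀ * L := by
    have hl1nn : 0 ≤ l1norm θ₀ := Finset.sum_nonneg fun i _ => abs_nonneg _
    have hC : 0 < C₁ := by
      have : 0 < 2 * (d : ℝ) * τ := by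
        have : (0 : ℝ) < d := by linarith
        positivity
      linarith
    rw [hL, hsc]
    refine sum_log_le_card_mul_log S (fun i _ => hx i) (by rw [← hsc]; positivity) ?_
    rw [← hsc]
    have e : (l0norm θ₀ : ℝ) * (C₁ / (τ * l0norm θ₀)) = C₁ / τ := by field_simp
    rw [e, Finset.sum_add_distrib, Finset.sum_const, nsmul_eq_mul, ← Finset.sum_div, ← hsc]
    have hle : ∑ i ∈ S, |θ₀ i| ≤ l1norm θ₀ :=
      Finset.sum_le_univ_sum_of_nonneg fun i => abs_nonneg _
    rw [le_div_iff₀ hτ, add_mul, div_mul_cancel₀ _ hτ.ne']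
    nlinarith [mul_le_mul_of_nonneg_right hsd' hτ.le]
  have hsumI : ∑ i ∈ I, Real.log (2 + |θ₀ i| / τ) ≤ l0norm θ₀ * L + I.card * Real.log 2 := by
    rw [← Finset.sum_sdiff hI, add_comm]
    refine add_le_add hsumS ?_
    have h0 : ∀ i ∈ I \ S, Real.log (2 + |θ₀ i| / τ) = Real.log 2 := by
      intro i hi
      have : θ₀ i = 0 := by
        by_contra hne
        exact (Finset.mem_sdiff.1 hi).2 (by simp [hS, hne])
      simp [this]
    rw [Finset.sum_congr rfl h0, Finset.sum_const, nsmul_eq_mul]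
    gcongr
    exact Finset.sdiff_subset
  have hsL : (l0norm θ₀ : ℝ) ≤ l0norm θ₀ * L / Real.log 2 := by
    rw [le_div_iff₀ h2]
    gcongr
  have hL0 : 0 < L := h2.trans_le hL2
  have hsL1 : Real.log 2 ≤ l0norm θ₀ * L := hL2.trans (by nlinarith)
  have hD : 0 ≤ D := by
    by_contra hneg
    have : (0 : ℝ) ≤ I.card := Nat.cast_nonneg _
    nlinarith
  -- Constant costs per coordinate are absorbed through s ≤ sL/log 2.
  have hcost : I.card * (-Real.log h + 4 * Real.log 2) ≤
      D * ((-Real.log h + 4 * Real.log 2) / Real.log 2) * (l0norm θ₀ * L) := by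
    calc I.card * (-Real.log h + 4 * Real.log 2) ≤
          D * (l0norm θ₀ * L / Real.log 2) * (-Real.log h + 4 * Real.log 2) := by
          gcongr
          exact hcard.trans (by gcongr)
      _ = _ := by ring
  rw [hlog, add_mul]
  linarith

end FracPosterior

/-! ### Choice of constants and conclusion -/

open FracPosterior in
theorem mainTheorem12 (σmin σmax a : ℝ) (hσmin : 0 < σmin) (hσmax : 0 < σmax) (ha : 0 < a) :
    ∃ c : ℝ, 0 < c ∧
      ∀ (α : ℝ), 0 < α → α < 1 →
      ∀ (n d : ℕ) (Cx C₁ : ℝ), 0 < Cx → 0 < C₁ →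
      -- the law of the covariates, with its second moment bound
      ∀ (Q : Measure (FracPosterior.Vec d)), IsProbabilityMeasure Q →
      Integrable (fun x => ‖x‖ ^ 2) Q → ∫ x, ‖x‖ ^ 2 ∂Q < Cx ^ 2 →
      -- the true parameters
      ∀ (θ₀ : FracPosterior.Vec d) (σ₀ : ℝ), 0 < σ₀ →
      (2 * σmin)⁻¹ < σ₀ ^ 2 → σ₀ ^ 2 < (2 * σmax)⁻¹ →
      1 ≤ FracPosterior.l0norm θ₀ → FracPosterior.l0norm θ₀ < n → n < d →
      -- the tuning parameters and the rate
      ∀ (τ b ε : ℝ), τ = 1 / (Cx * Real.sqrt (n * d)) → b = 1 / Real.sqrt n →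
      ε = c * FracPosterior.l0norm θ₀ *
        Real.log (Cx * C₁ * Real.sqrt (n * d) / FracPosterior.l0norm θ₀) / n →
      FracPosterior.l1norm θ₀ ≤ C₁ - 2 * d * τ →
      1 - 2 / (n * ε) ≤
        (Measure.pi fun _ : Fin n => FracPosterior.modelLaw Q θ₀ σ₀).real
          {z | ∫⁻ p, (FracPosterior.renyiDiv α (FracPosterior.modelLaw Q p.1 p.2)
                  (FracPosterior.modelLaw Q θ₀ σ₀)).toENNReal
                ∂(FracPosterior.fracPosterior α (FracPosterior.prior d τ C₁ a b) z) ≤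
              ENNReal.ofReal (2 * (α + 1) / (1 - α) * ε)} := by
  have h2 : 0 < Real.log 2 := Real.log_pos one_lt_two
  have hG := Real.Gamma_pos_of_pos ha
  -- The constant of `le_sigmaPrior_precisionWindow` for precisions between 2σmax and 2σmin: despite
  -- the names, `σmax` bounds σ₀⁻² from below and `σmin` from above.
  set K₁ : ℝ := 2 * σmax * ((Real.Gamma a)⁻¹ * ((2 * σmax) ^ a / (2 * (2 * σmin))) *
    Real.exp (-(2 * (2 * σmin)))) with hK₁
  have hK₁pos : 0 < K₁ := by positivity
  -- With g = σ₀⁻² ≤ 2σmin this gives h² ≤ h ≤ 1/(4g), so the uniform coordinates meet the variance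
  -- bound in every dimension.
  set h : ℝ := min 1 (8 * σmin)⁻¹ with hh
  have hhpos : 0 < h := lt_min one_pos (by positivity)
  have hh1 : h ≤ 1 := min_le_left _ _
  have hlogh : 0 ≤ -Real.log h := neg_nonneg.2 (Real.log_nonpos hhpos.le hh1)
  set D : ℝ := 1 + 8 * σmin with hD
  have hDpos : 0 < D := by positivity
  -- In units of sL: 5 is one for the factor 1/2 and four for the Student tails on the support; the
  -- `D` term is the constant cost per localised coordinate; the last two terms are `K₁` and the
  -- power of n in the mass of the precision window.
  refine ⟨5 + D * ((-Real.log h + 4 * Real.log 2) / Real.log 2) + |Real.log K₁| / Real.log 2 +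
    (1 + a / 2) / Real.log 2, by positivity, ?_⟩
  intro α h0 h1 n d Cx C₁ hCx hC₁ Q hQprob hQ hQ2 θ₀ σ₀ hσ₀ hσlo hσhi hs hsn hnd τ b ε hτ hb hε hl1
  set s := l0norm θ₀ with hsdef
  have hn1 : 1 ≤ n := by omega
  have hnpos : (0 : ℝ) < n := by exact_mod_cast hn1
  have hdpos : (0 : ℝ) < d := by exact_mod_cast (by omega : 0 < d)
  have hspos : (0 : ℝ) < s := by exact_mod_cast hs
  have hτpos : 0 < τ := by rw [hτ]; positivity
  have hbpos : 0 < b := by rw [hb]; positivity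
  have hτsq : τ ^ 2 * (Cx ^ 2 * (n * d)) = 1 := by
    rw [hτ, div_pow, mul_pow, Real.sq_sqrt (by positivity)]
    field_simp
  -- the precision of the noise
  have hg_lo : 2 * σmax ≤ (σ₀ ^ 2)⁻¹ := by
    rw [← inv_inv (2 * σmax)]
    exact inv_anti₀ (by positivity) hσhi.le
  have hg_hi : (σ₀ ^ 2)⁻¹ ≤ 2 * σmin := by
    rw [← inv_inv (2 * σmin)]
    exact inv_anti₀ (by positivity) hσlo.le
  set g : ℝ := (σ₀ ^ 2)⁻¹ with hg
  have hgpos : 0 < g := by positivity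
  -- the rate
  set L : ℝ := Real.log (C₁ / (τ * s)) with hL
  have hLarg : Cx * C₁ * Real.sqrt (n * d) / s = C₁ / (τ * s) := by
    rw [hτ]
    field_simp
  rw [hLarg, ← hL] at hε
  have hl1nn : 0 ≤ l1norm θ₀ := Finset.sum_nonneg fun i _ => abs_nonneg _
  obtain ⟨hL2, hlogd⟩ : Real.log 2 ≤ L ∧ Real.log d ≤ s * L / Real.log 2 := by
    refine log_le_mul_of_log_div_le hs (by omega) (Real.log_le_log (by positivity) ?_)
    have : 2 * d * τ ≤ C₁ := by linarith
    calc 2 * d / (s : ℝ) = 2 * d * τ / (τ * s) := by field_simp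
      _ ≤ _ := by gcongr
  have hLpos : 0 < L := h2.trans_le hL2
  have hsL : 0 < s * L := by positivity
  set c : ℝ := 5 + D * ((-Real.log h + 4 * Real.log 2) / Real.log 2) + |Real.log K₁| / Real.log 2 +
    (1 + a / 2) / Real.log 2 with hc
  have hcpos : 0 < c := by positivity
  have hR : (n : ℝ) * ε = c * (s * L) := by
    rw [hε]
    field_simp
  have hRpos : 0 < n * ε := by rw [hR]; positivity
  -- the coordinates on which the prior is localised
  obtain ⟨I, hI, hcard, hIM⟩ : ∃ I : Finset (Fin d), (Finset.univ.filter fun i => θ₀ i ≠ 0) ⊆ I ∧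
      (I.card : ℝ) ≤ D * s ∧
      ∀ i, (if i ∈ I then (h * τ) ^ 2 else τ ^ 2) ≤ d * τ ^ 2 / (4 * g) := by
    have hd1 : (1 : ℝ) ≤ d := by exact_mod_cast (by omega : 1 ≤ d)
    have hs1 : (1 : ℝ) ≤ s := by exact_mod_cast hs
    have hin : (h * τ) ^ 2 ≤ d * τ ^ 2 / (4 * g) := by
      have hle : h ≤ (8 * σmin)⁻¹ := min_le_right _ _
      have hinv : (8 * σmin)⁻¹ ≤ (4 * g)⁻¹ := inv_anti₀ (by positivity) (by linarith)
      have hsq : h ^ 2 ≤ (4 * g)⁻¹ :=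
        (pow_le_of_le_one hhpos.le hh1 two_ne_zero).trans (hle.trans hinv)
      calc (h * τ) ^ 2 = 1 * (h ^ 2 * τ ^ 2) := by ring
        _ ≤ d * ((4 * g)⁻¹ * τ ^ 2) := by gcongr
        _ = _ := by ring
    -- A Student coordinate has variance τ², within the bound only if 4g ≤ d. For d ≤ 8σmin this may
    -- fail, so all coordinates are localised; there are at most 8σmin of them, which is why `D`
    -- contains that term.
    by_cases hd8 : (d : ℝ) ≤ 8 * σmin
    · refine ⟨Finset.univ, Finset.subset_univ _, ?_, fun i => by simpa using hin⟩
      rw [Finset.card_univ, Fintype.card_fin]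
      exact (hd8.trans (by linarith)).trans (le_mul_of_one_le_right hDpos.le hs1)
    · refine ⟨Finset.univ.filter fun i => θ₀ i ≠ 0, subset_rfl, ?_, fun i => ?_⟩
      · change (s : ℝ) ≤ D * s
        exact le_mul_of_one_le_left hspos.le (by linarith)
      · split_ifs
        · exact hin
        · rw [le_div_iff₀ (by positivity), mul_comm]
          have : 4 * g ≤ d := by linarith
          gcongr
  -- Calibrated so that 2gM Cx² = τ²Cx²d/2 = 1/(2n), the share of the mean excess left to the
  -- covariates.
  set M : ℝ := d * τ ^ 2 / (4 * g) with hM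
  have hMpos : 0 < M := by positivity
  have hI' : ∀ i, i ∉ I → θ₀ i = 0 := by
    intro i hi
    by_contra hne
    exact hi (hI (by simp [hne]))
  obtain ⟨ρ, hρprob, hρneg, hρsq, hρκ⟩ := exists_local_prior (by omega) θ₀ hτpos hl1 hhpos hh1 I hI' hIM
  obtain ⟨hκpos, hκlog⟩ := localization_cost_le θ₀ hτpos hs (by omega) hl1 hhpos hh1 hL hL2 I hI hcard
  set κ : ℝ := 2⁻¹ * ∏ i ∈ I, (h * ((2 + |θ₀ i| / τ) ^ 4)⁻¹) with hκ
  have hσmass := le_sigmaPrior_precisionWindow ha (by positivity) hg_lo hg_hi hn1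
  rw [← hK₁, ← hb] at hσmass
  set κσ : ℝ := K₁ * Real.exp (-((1 + a / 2) * Real.log n)) with hκσ
  have hκσpos : 0 < κσ := by positivity
  have hκR : Real.exp (-(n * ε)) ≤ κσ * κ := by
    rw [← Real.le_log_iff_exp_le (by positivity), Real.log_mul hκσpos.ne' hκpos.ne', hκσ,
      Real.log_mul hK₁pos.ne' (Real.exp_pos _).ne', Real.log_exp]
    have hlogn : Real.log n ≤ s * L / Real.log 2 :=
      (Real.log_le_log hnpos (by exact_mod_cast hnd.le)).trans hlogd
    have hA : (1 + a / 2) * Real.log n ≤ (1 + a / 2) / Real.log 2 * (s * L) := by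
      calc _ ≤ (1 + a / 2) * (s * L / Real.log 2) := by gcongr
        _ = _ := by ring
    have hB : -Real.log K₁ ≤ |Real.log K₁| / Real.log 2 * (s * L) := by
      have hone : 1 ≤ s * L / Real.log 2 := by
        rw [le_div_iff₀ h2, one_mul]
        exact hL2.trans (le_mul_of_one_le_left hLpos.le (by exact_mod_cast hs))
      calc -Real.log K₁ ≤ |Real.log K₁| := neg_le_abs _
        _ ≤ |Real.log K₁| * (s * L / Real.log 2) := le_mul_of_one_le_right (abs_nonneg _) hone
        _ = _ := by ring
    have hsplit : (n : ℝ) * ε = (5 + D * ((-Real.log h + 4 * Real.log 2) / Real.log 2)) * (s * L) +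
        |Real.log K₁| / Real.log 2 * (s * L) + (1 + a / 2) / Real.log 2 * (s * L) := by
      rw [hR, hc]
      ring
    linarith
  have hπθ := isProbabilityMeasure_thetaPrior d hτpos hC₁
  have hπσ := isProbabilityMeasure_sigmaPrior ha hbpos
  have hπ : IsProbabilityMeasure (prior d τ C₁ a b) := by
    unfold prior
    infer_instance
  have hP := isProbabilityMeasure_modelLaw Q θ₀ σ₀
  have hMn : 2 * g * M * Cx ^ 2 ≤ 1 / (2 * n) := by
    have e : 2 * g * M * Cx ^ 2 = τ ^ 2 * (Cx ^ 2 * (n * d)) / (2 * n) := by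
      rw [hM]
      field_simp
      norm_num
    rw [e, hτsq]
  have hexc := lintegral_excess_le hn1 Q hMpos.le hQ hQ2.le θ₀ hσ₀ hMn
  have hexcm : Measurable fun z : Fin n → ℝ × Vec d => ∑ i, ENNReal.ofReal (excess n M θ₀ σ₀ (z i)) := by
    have hm := (measurable_excess n M θ₀ σ₀).ennreal_ofReal
    exact Finset.measurable_sum _ fun i _ => hm.comp (measurable_pi_apply i)
  refine measureReal_ge_of_compl_subset _ (measurable_ratioIntegral α Q θ₀ σ₀ (prior d τ C₁ a b)) hexcm
    (lintegral_ratioIntegral_le α Q θ₀ σ₀ _) (lintegral_sum_excess_le hn1 _ θ₀ σ₀ hexc) hRpos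
    fun z hV hW => ?_
  have hF : ∑ i, excess n M θ₀ σ₀ (z i) ≤ n * ε := by
    rw [← ENNReal.ofReal_sum_of_nonneg fun i _ => excess_nonneg n hMpos.le θ₀ σ₀ (z i)] at hW
    exact (ENNReal.ofReal_le_ofReal_iff hRpos.le).1 hW.le
  have hev := le_lintegral_prior hn1 h0 ha hbpos hρneg hMpos.le hρsq θ₀ hσ₀ hρκ hσmass hκpos.le
    hκσpos.le z
  have hfin := lintegral_renyiDiv_le hn1 h0 h1 hτpos hC₁ ha hbpos Q θ₀ hσ₀ hRpos hκR z hev hV.le hF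
  refine le_of_le_of_eq hfin ?_
  congr 1
  have : 1 - α ≠ 0 := by linarith
  field_simp
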